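/- There exist absolute constants $\delta > 0$ (a real number) and $k \geq 1$ (an integer) such that the following holds. Let $\mathbb{F}_q$ be any finite field (in particular $\mathbb{F}_p$ for any prime $p$), let $G = \mathrm{SL}_2(\mathbb{F}_q)$ with identity element $e$, and let $A \subset G$ be a set that generates $G$. Then either \[ |A^3| \geq |A|^{1+\delta} \] or \[ (A \cup A^{-1} \cup \{e\})^k = G . \] Here $A^{-1} = \{a^{-1} : a \in A\}$, and for $S \subset G$ and an integer $m \geq 1$, $S^m = \{s_1 s_2 \cdots s_m : s_1, \dots, s_m \in S\}$. The constants $\delta$ and $k$ depend neither on $q$ nor on $A$. -/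

import Mathlib

open scoped Pointwise

/-!
# Growth in `SL₂` over a finite field

Let `B = A ∪ A⁻¹ ∪ {1}`, `q = |F|`, and suppose that `|A ^ 3|` is less than `|A| ^ (1 + δ)`.
By the Ruzsa calculus (`Finset.card_symm_pow_three_le`) every bounded power of `B` then has at most
`|B| ^ (1 + O(δ))` elements.

Dimensional estimate (`SLTwo.card_trace_pow_three_le`): for `t ≠ 0, ± 2` a power of `B` meets
the class `tr = t` in at most `|B| ^ (2 / 3 + O(δ))` elements. The map `(x, y, z) ↦ (x y, x z)` on
triples of trace `t` is at most two-to-one outside a small set: given `x y` and `x z`, the equations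
`tr x = tr y = tr z = t` are linear in `x` and cut out a line, which meets the quadric `det x = 1`
in two points or is contained in it. The second case forces `x` and `y` to have a common
eigenvector, and a generating set moves every line of `F²`, which bounds the number of elements
with a given eigenvector (`SLTwo.card_isEigen_sq_le`).

By orbit-stabilizer, the centralizer of an element of `B ^ 4` of trace `≠ 0, ± 2` therefore
meets `B ^ 2` in at least `|B| ^ (1 / 3 - O(δ))` elements, and hence in one of trace `≠ 0, ± 2`.
This property of a torus passes to its conjugates under `B`, hence to all its conjugates
(`SLTwo.exists_torus`); it holds for some torus because `B ^ 3` spans the matrix algebra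
(`SLTwo.exists_trace_regular`). The roughly `q ^ 2` conjugates of a torus meet only in scalars
(`SLTwo.card_mul_le_of_torus`), so `|B| ≥ q ^ (3 - O(δ))` (`SLTwo.card_pow_six_le`).

A set this large has many unipotent and many upper triangular elements in its square. Averaging the
additive energy of `Y` and `d Y` over `d` (`SLTwo.exists_large_sumset`) shows that boundedly many
of them produce both unipotent subgroups, and these generate the group in four steps
(`SLTwo.pow_eq_univ_of_card`).

For bounded `q` the powers of `B` exhaust the group in boundedly many steps. For bounded `|A|` the
hypothesis says that `|A ^ 3| ≤ |A|`, so that `A` is a union of conjugacy classes, one of which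
has at least `q ^ 2 / 4` elements (`SLTwo.sq_card_le_of_card_pow_three_le`).
-/

open scoped MatrixGroups

/-! ### Matrix entries, traces and centralizers in `SL₂` -/

namespace SLTwo

variable {F : Type*} [Field F]

theorem det_eq (g : SL(2, F)) : g.1 0 0 * g.1 1 1 - g.1 0 1 * g.1 1 0 = 1 := by
  rw [← Matrix.det_fin_two, g.2]

theorem ext_entries {g h : SL(2, F)} (h00 : g.1 0 0 = h.1 0 0) (h01 : g.1 0 1 = h.1 0 1)
    (h10 : g.1 1 0 = h.1 1 0) (h11 : g.1 1 1 = h.1 1 1) : g = h := by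
  apply Subtype.ext
  ext i j
  fin_cases i <;> fin_cases j <;> assumption

theorem trace_eq (g : SL(2, F)) : g.1.trace = g.1 0 0 + g.1 1 1 := Matrix.trace_fin_two _

section entries
variable (g h : SL(2, F))

@[simp] theorem mul_00 : (g * h).1 0 0 = g.1 0 0 * h.1 0 0 + g.1 0 1 * h.1 1 0 := by
  change (g.1 * h.1) 0 0 = _
  simp [Matrix.mul_apply]
@[simp] theorem mul_01 : (g * h).1 0 1 = g.1 0 0 * h.1 0 1 + g.1 0 1 * h.1 1 1 := by
  change (g.1 * h.1) 0 1 = _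
  simp [Matrix.mul_apply]
@[simp] theorem mul_10 : (g * h).1 1 0 = g.1 1 0 * h.1 0 0 + g.1 1 1 * h.1 1 0 := by
  change (g.1 * h.1) 1 0 = _
  simp [Matrix.mul_apply]
@[simp] theorem mul_11 : (g * h).1 1 1 = g.1 1 0 * h.1 0 1 + g.1 1 1 * h.1 1 1 := by
  change (g.1 * h.1) 1 1 = _
  simp [Matrix.mul_apply]
@[simp] theorem inv_00 : (g⁻¹).1 0 0 = g.1 1 1 := by
  simp [Matrix.SpecialLinearGroup.SL2_inv_expl]
@[simp] theorem inv_01 : (g⁻¹).1 0 1 = -g.1 0 1 := by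
  simp [Matrix.SpecialLinearGroup.SL2_inv_expl]
@[simp] theorem inv_10 : (g⁻¹).1 1 0 = -g.1 1 0 := by
  simp [Matrix.SpecialLinearGroup.SL2_inv_expl]
@[simp] theorem inv_11 : (g⁻¹).1 1 1 = g.1 0 0 := by
  simp [Matrix.SpecialLinearGroup.SL2_inv_expl]
@[simp] theorem one_00 : (1 : SL(2, F)).1 0 0 = 1 := rfl
@[simp] theorem one_01 : (1 : SL(2, F)).1 0 1 = 0 := rfl
@[simp] theorem one_10 : (1 : SL(2, F)).1 1 0 = 0 := rfl
@[simp] theorem one_11 : (1 : SL(2, F)).1 1 1 = 1 := rfl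
@[simp] theorem neg_ij (i j : Fin 2) : (-g).1 i j = -(g.1 i j) := by
  simp
end entries

/-- `g` is a scalar matrix, i.e. `g = ±1`. -/
def IsScalar (g : SL(2, F)) : Prop := g.1 0 1 = 0 ∧ g.1 1 0 = 0 ∧ g.1 0 0 = g.1 1 1

theorem IsScalar.commute {g : SL(2, F)} (hg : IsScalar g) (h : SL(2, F)) : g * h = h * g := by
  obtain ⟨h1, h2, h3⟩ := hg
  apply ext_entries <;> simp [h1, h2, h3] <;> ring

theorem IsScalar.trace_sq {g : SL(2, F)} (hg : IsScalar g) : g.1.trace ^ 2 = 4 := by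
  obtain ⟨h1, h2, h3⟩ := hg
  have := det_eq g
  rw [trace_eq]
  simp only [h1, h3] at *
  linear_combination 4 * this

theorem trace_conj (g x : SL(2, F)) : (x * g * x⁻¹).1.trace = g.1.trace := by
  have := det_eq x
  simp only [trace_eq, mul_00, mul_01, mul_10, mul_11, inv_00, inv_01, inv_10, inv_11]
  linear_combination (g.1 0 0 + g.1 1 1) * this

theorem trace_conj' (g x : SL(2, F)) : (x⁻¹ * g * x).1.trace = g.1.trace := by
  simpa using trace_conj g x⁻¹

/-- The centralizer of a non-scalar `x` lies in the algebra `F[x]`. -/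
theorem exists_of_commute {x y : SL(2, F)} (hx : ¬ IsScalar x) (h : y * x = x * y) :
    ∃ a b : F, y.1 0 0 = a + b * x.1 0 0 ∧ y.1 0 1 = b * x.1 0 1 ∧ y.1 1 0 = b * x.1 1 0 ∧
      y.1 1 1 = a + b * x.1 1 1 := by
  have e00 : (y * x).1 0 0 = (x * y).1 0 0 := by rw [h]
  have e01 : (y * x).1 0 1 = (x * y).1 0 1 := by rw [h]
  have e10 : (y * x).1 1 0 = (x * y).1 1 0 := by rw [h]
  simp only [mul_00, mul_01, mul_10] at e00 e01 e10
  by_cases h1 : x.1 0 1 = 0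
  · by_cases h2 : x.1 1 0 = 0
    · have h3 : x.1 0 0 - x.1 1 1 ≠ 0 := fun h3 ↦ hx ⟨h1, h2, sub_eq_zero.1 h3⟩
      have h4 : y.1 0 1 = 0 := by
        apply mul_left_cancel₀ h3
        linear_combination -e01 + y.1 0 0 * h1 - h1 * y.1 1 1
      have h5 : y.1 1 0 = 0 := by
        apply mul_left_cancel₀ h3
        linear_combination e10 + y.1 0 0 * h2 - h2 * y.1 1 1
      refine ⟨y.1 0 0 - (y.1 0 0 - y.1 1 1) / (x.1 0 0 - x.1 1 1) * x.1 0 0,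
        (y.1 0 0 - y.1 1 1) / (x.1 0 0 - x.1 1 1), by ring, by simp [h4, h1], by simp [h5, h2], ?_⟩
      field_simp
      ring
    · refine ⟨y.1 0 0 - y.1 1 0 / x.1 1 0 * x.1 0 0, y.1 1 0 / x.1 1 0, by ring, ?_, ?_, ?_⟩
      · field_simp
        linear_combination e00
      · field_simp
      · field_simp
        linear_combination e10
  · refine ⟨y.1 0 0 - y.1 0 1 / x.1 0 1 * x.1 0 0, y.1 0 1 / x.1 0 1, by ring, ?_, ?_, ?_⟩
    · field_simp
    · field_simp
      linear_combination -e00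
    · field_simp
      linear_combination -e01

/-- Elements of `F[x]` of determinant one with a prescribed coefficient of `x` come in pairs. -/
theorem eq_or_eq_neg_inv {y z : SL(2, F)} {s : F} (h00 : z.1 0 0 = y.1 0 0 + s)
    (h01 : z.1 0 1 = y.1 0 1) (h10 : z.1 1 0 = y.1 1 0) (h11 : z.1 1 1 = y.1 1 1 + s) :
    z = y ∨ z = -y⁻¹ := by
  have hz := det_eq z
  have hy := det_eq y
  rw [h00, h01, h10, h11] at hz
  have : s * (s + (y.1 0 0 + y.1 1 1)) = 0 := by linear_combination hz - hy
  rcases mul_eq_zero.1 this with h | h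
  · left
    apply ext_entries <;> simp [*]
  · right
    apply ext_entries <;> simp only [neg_ij, inv_00, inv_01, inv_10, inv_11]
    · linear_combination h00 + h
    · rw [h01, neg_neg]
    · rw [h10, neg_neg]
    · linear_combination h11 + h

/-- A torus contains, with `y`, only `y⁻¹` as another element of the same trace. -/
theorem eq_or_eq_inv_of_commute {x y z : SL(2, F)} (hx : x.1.trace ^ 2 ≠ 4)
    (hy : y * x = x * y) (hz : z * x = x * z) (hyz : z.1.trace = y.1.trace) :
    z = y ∨ z = y⁻¹ := by
  have hxs : ¬ IsScalar x := fun h ↦ hx h.trace_sq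
  obtain ⟨a, b, h1, h2, h3, h4⟩ := exists_of_commute hxs hy
  obtain ⟨c, d, k1, k2, k3, k4⟩ := exists_of_commute hxs hz
  have dx := det_eq x
  have dy := det_eq y
  have dz := det_eq z
  simp only [trace_eq] at *
  rw [h1, h2, h3, h4] at dy
  rw [k1, k2, k3, k4] at dz
  rw [h1, h4, k1, k4] at hyz
  set t := x.1 0 0 + x.1 1 1 with ht
  have e : (d - b) * (d + b) = 0 := by
    have : t ^ 2 - 4 ≠ 0 := sub_ne_zero.2 hx
    apply mul_left_cancel₀ this
    have h5 : (2 * c + d * t) ^ 2 = (2 * a + b * t) ^ 2 := by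
      congr 1
      linear_combination hyz
    linear_combination h5 - 4 * dz + 4 * dy + 4 * (d ^ 2 - b ^ 2) * dx
  have ha : a ^ 2 + a * b * t + b ^ 2 = 1 := by
    linear_combination dy - b ^ 2 * dx
  have hc : c ^ 2 + c * d * t + d ^ 2 = 1 := by
    linear_combination dz - d ^ 2 * dx
  have key : (d = b ∧ c = a) ∨ (d = -b ∧ c = a + b * t) := by
    rcases mul_eq_zero.1 e with e | e
    · have e' : d = b := by linear_combination e
      subst e'
      have : (c - a) * (c + a + d * t) = 0 := by linear_combination hc - ha
      rcases mul_eq_zero.1 this with e2 | e2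
      · left
        exact ⟨rfl, by linear_combination e2⟩
      · have h2 : 2 * c = 2 * a := by linear_combination hyz
        by_cases hchar : (2 : F) = 0
        · right
          exact ⟨by linear_combination d * hchar, by linear_combination e2 - (a + d * t) * hchar⟩
        · left
          exact ⟨rfl, mul_left_cancel₀ hchar h2⟩
    · have e' : d = -b := by linear_combination e
      subst e'
      have : (c - a - b * t) * (c + a) = 0 := by linear_combination hc - ha
      rcases mul_eq_zero.1 this with e2 | e2
      · right
        exact ⟨rfl, by linear_combination e2⟩
      · have h2 : 2 * c = 2 * (a + b * t) := by linear_combination hyz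
        by_cases hchar : (2 : F) = 0
        · left
          exact ⟨by linear_combination -b * hchar, by linear_combination e2 - a * hchar⟩
        · right
          exact ⟨rfl, mul_left_cancel₀ hchar h2⟩
  rcases key with ⟨rfl, rfl⟩ | ⟨rfl, rfl⟩
  · left
    apply ext_entries <;> simp [*]
  · right
    apply ext_entries <;> simp only [inv_00, inv_01, inv_10, inv_11]
    · linear_combination k1 - h4 + b * ht
    · linear_combination k2 + h2
    · linear_combination k3 + h3
    · linear_combination k4 - h1 + b * ht

section Finite
variable [Fintype F] [DecidableEq F]

theorem card_commute_le {x : SL(2, F)} (hx : ¬ IsScalar x) :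
    (Finset.univ.filter fun y : SL(2, F) ↦ y * x = x * y).card ≤ 2 * Fintype.card F := by
  classical
  have H : ∀ y : SL(2, F), ∃ b : F, y * x = x * y → ∃ a : F, y.1 0 0 = a + b * x.1 0 0 ∧
      y.1 0 1 = b * x.1 0 1 ∧ y.1 1 0 = b * x.1 1 0 ∧ y.1 1 1 = a + b * x.1 1 1 := by
    intro y
    by_cases h : y * x = x * y
    · obtain ⟨a, b, h⟩ := exists_of_commute hx h
      exact ⟨b, fun _ ↦ ⟨a, h⟩⟩
    · exact ⟨0, fun h' ↦ absurd h' h⟩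
  choose f hf using H
  refine (Finset.card_le_mul_card_image (f := f) _ 2 ?_).trans
    (Nat.mul_le_mul_left 2 (Finset.card_le_univ _))
  intro b hb
  obtain ⟨y, hy, rfl⟩ := Finset.mem_image.1 hb
  refine (Finset.card_le_card (t := {y, -y⁻¹}) ?_).trans Finset.card_le_two
  intro z hz
  simp only [Finset.mem_filter, Finset.mem_univ, true_and, Finset.mem_insert,
    Finset.mem_singleton] at hz hy ⊢
  obtain ⟨a, h1, h2, h3, h4⟩ := hf y hy
  obtain ⟨c, k1, k2, k3, k4⟩ := hf z hz.1
  rw [hz.2] at k1 k2 k3 k4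
  exact eq_or_eq_neg_inv (s := c - a) (by rw [k1, h1]; ring) (by rw [k2, h2]) (by rw [k3, h3])
    (by rw [k4, h4]; ring)

theorem card_conj_eq_le {x y : SL(2, F)} (hx : ¬ IsScalar x) :
    (Finset.univ.filter fun g : SL(2, F) ↦ g⁻¹ * x * g = y).card ≤ 2 * Fintype.card F := by
  rcases (Finset.univ.filter fun g : SL(2, F) ↦ g⁻¹ * x * g = y).eq_empty_or_nonempty with h | h
  · rw [h]; simp
  · obtain ⟨g, hg⟩ := h
    refine le_trans ?_ (card_commute_le hx)
    refine Finset.card_le_card_of_injOn (fun h ↦ h * g⁻¹) ?_ (by intro a _ b _; simp)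
    intro h hh
    simp only [Finset.coe_filter, Finset.mem_univ, true_and, Set.mem_ofPred_eq,
      Finset.mem_filter] at hg hh ⊢
    rw [← hg] at hh
    have : g * (h⁻¹ * x * h) * g⁻¹ = g * (g⁻¹ * x * g) * g⁻¹ := by rw [hh]
    have h2 : x = (h * g⁻¹)⁻¹ * x * (h * g⁻¹) := by simpa [mul_assoc] using this.symm
    calc h * g⁻¹ * x = h * g⁻¹ * ((h * g⁻¹)⁻¹ * x * (h * g⁻¹)) := by rw [← h2]
      _ = x * (h * g⁻¹) := by group

theorem card_le_pow_four : Fintype.card SL(2, F) ≤ Fintype.card F ^ 4 := by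
  have : Fintype.card (F × F × F × F) = Fintype.card F ^ 4 := by
    simp only [Fintype.card_prod]; ring
  rw [← this]
  refine Fintype.card_le_of_injective (fun g ↦ (g.1 0 0, g.1 0 1, g.1 1 0, g.1 1 1)) ?_
  intro g h hgh
  simp only [Prod.mk.injEq] at hgh
  exact ext_entries hgh.1 hgh.2.1 hgh.2.2.1 hgh.2.2.2

theorem pow_three_le_card : Fintype.card F ^ 3 ≤ 2 * Fintype.card SL(2, F) := by
  have h1 : Fintype.card (Fˣ × F × F) ≤ Fintype.card SL(2, F) := by
    refine Fintype.card_le_of_injective (fun p ↦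
      (⟨!![(p.1 : F), p.2.1; p.2.2, (1 + p.2.1 * p.2.2) / p.1], ?_⟩ : SL(2, F))) ?_
    · rw [Matrix.det_fin_two_of]
      field_simp [p.1.ne_zero]
      ring
    · rintro ⟨a, b, c⟩ ⟨a', b', c'⟩ h
      have h0 := congrArg Subtype.val h
      have e1 := congrFun (congrFun h0 0) 0
      have e2 := congrFun (congrFun h0 0) 1
      have e3 := congrFun (congrFun h0 1) 0
      simp at e1 e2 e3
      simp [Units.ext e1, e2, e3]
  simp only [Fintype.card_prod, Fintype.card_units] at h1
  have h2 : 2 ≤ Fintype.card F := Fintype.one_lt_card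
  obtain ⟨q, hq⟩ := Nat.exists_eq_add_of_le h2
  rw [hq] at h1 ⊢
  have : 2 + q - 1 = 1 + q := by omega
  rw [this] at h1
  nlinarith [Nat.zero_le q, sq_nonneg q]

end Finite
end SLTwo

/-! ### Common eigenvectors and spans of generating sets -/

namespace SLTwo

variable {F : Type*} [Field F]

/-- The vector `v` satisfies `g v = l v`. -/
def IsEigen (g : SL(2, F)) (v : F × F) (l : F) : Prop :=
  g.1 0 0 * v.1 + g.1 0 1 * v.2 = l * v.1 ∧ g.1 1 0 * v.1 + g.1 1 1 * v.2 = l * v.2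

theorem exists_isEigen {g : SL(2, F)} {v : F × F} (hv : v ≠ 0)
    (h : v.1 * (g.1 1 0 * v.1 + g.1 1 1 * v.2) = v.2 * (g.1 0 0 * v.1 + g.1 0 1 * v.2)) :
    ∃ l, IsEigen g v l := by
  by_cases h1 : v.1 = 0
  · have h2 : v.2 ≠ 0 := fun h2 ↦ hv (Prod.ext h1 h2)
    refine ⟨(g.1 1 0 * v.1 + g.1 1 1 * v.2) / v.2, ?_, by field_simp⟩
    field_simp
    linear_combination -h
  · refine ⟨(g.1 0 0 * v.1 + g.1 0 1 * v.2) / v.1, by field_simp, ?_⟩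
    field_simp
    linear_combination h

theorem IsEigen.mul {g h : SL(2, F)} {v : F × F} {l m : F} (hg : IsEigen g v l)
    (hh : IsEigen h v m) : IsEigen (g * h) v (m * l) := by
  obtain ⟨h1, h2⟩ := hg
  obtain ⟨h3, h4⟩ := hh
  constructor <;> simp only [mul_00, mul_01, mul_10, mul_11]
  · linear_combination g.1 0 0 * h3 + g.1 0 1 * h4 + m * h1
  · linear_combination g.1 1 0 * h3 + g.1 1 1 * h4 + m * h2

theorem IsEigen.inv {g : SL(2, F)} {v : F × F} {l : F} (hv : v ≠ 0) (hg : IsEigen g v l) :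
    IsEigen g⁻¹ v l⁻¹ := by
  obtain ⟨h1, h2⟩ := hg
  have hd := det_eq g
  have e1 : v.1 = l * (g.1 1 1 * v.1 - g.1 0 1 * v.2) := by
    linear_combination -v.1 * hd + g.1 1 1 * h1 - g.1 0 1 * h2
  have e2 : v.2 = l * (-g.1 1 0 * v.1 + g.1 0 0 * v.2) := by
    linear_combination -v.2 * hd - g.1 1 0 * h1 + g.1 0 0 * h2
  have hl : l ≠ 0 := by
    rintro rfl
    rw [zero_mul] at e1 e2
    exact hv (Prod.ext e1 e2)
  constructor <;> simp only [inv_00, inv_01, inv_10, inv_11]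
  · field_simp
    linear_combination -e1
  · field_simp
    linear_combination -e2

/-- A generating set does not preserve a line. -/
theorem exists_not_parallel {A : Set SL(2, F)} (hA : Subgroup.closure A = ⊤) {v : F × F}
    (hv : v ≠ 0) : ∃ a ∈ A,
      v.1 * (a.1 1 0 * v.1 + a.1 1 1 * v.2) - v.2 * (a.1 0 0 * v.1 + a.1 0 1 * v.2) ≠ 0 := by
  by_contra! H
  have key : ∀ g : SL(2, F), ∃ l, IsEigen g v l := by
    intro g
    have hg : g ∈ Subgroup.closure A := by rw [hA]; trivial
    induction hg using Subgroup.closure_induction with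
    | mem x hx => exact exists_isEigen hv (sub_eq_zero.1 (H x hx))
    | one => exact ⟨1, by simp [IsEigen]⟩
    | mul x y _ _ hx hy =>
      obtain ⟨l, hl⟩ := hx
      obtain ⟨m, hm⟩ := hy
      exact ⟨_, hl.mul hm⟩
    | inv x _ hx =>
      obtain ⟨l, hl⟩ := hx
      exact ⟨_, hl.inv hv⟩
  obtain ⟨l, h1, h2⟩ := key ⟨!![1, 1; 0, 1], by simp [Matrix.det_fin_two_of]⟩
  obtain ⟨m, h3, h4⟩ := key ⟨!![1, 0; 1, 1], by simp [Matrix.det_fin_two_of]⟩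
  simp at h1 h2 h3 h4
  apply hv
  have e2 : v.2 * v.2 = 0 := by linear_combination v.2 * h1 - v.1 * h2
  have e1 : v.1 * v.1 = 0 := by linear_combination v.1 * h4 - v.2 * h3
  exact Prod.ext (mul_self_eq_zero.1 e1) (mul_self_eq_zero.1 e2)

/-- If `a` moves the line `F v`, then `(x, y) ↦ x a y` is injective on pairs of elements having
`v` as an eigenvector of eigenvalue `l`. -/
theorem card_isEigen_sq_le [DecidableEq SL(2, F)] {A : Finset SL(2, F)}
    (hA : Subgroup.closure (A : Set SL(2, F)) = ⊤) {v : F × F} (hv : v ≠ 0) (l : F)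
    {S : Finset SL(2, F)} (hSA : S ⊆ A) (hS : ∀ x ∈ S, IsEigen x v l) :
    S.card ^ 2 ≤ (A ^ 3).card := by
  obtain ⟨a, ha, hav⟩ := exists_not_parallel hA hv
  rw [sq, ← Finset.card_product]
  refine Finset.card_le_card_of_injOn (fun p ↦ p.1 * a * p.2) ?_ ?_
  · rintro ⟨x, y⟩ hxy
    simp only [Finset.coe_product, Set.mem_prod, Finset.mem_coe] at hxy
    have : A ^ 3 = A * A * A := by rw [pow_succ, sq]
    rw [this]
    exact Finset.mul_mem_mul (Finset.mul_mem_mul (hSA hxy.1) ha) (hSA hxy.2)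
  · rintro ⟨x, y⟩ hxy ⟨x', y'⟩ hxy' h
    simp only [Finset.coe_product, Set.mem_prod, Finset.mem_coe] at hxy hxy' h
    obtain ⟨hx1, hx2⟩ := hS x hxy.1
    obtain ⟨hy1, hy2⟩ := hS y hxy.2
    obtain ⟨hx1', hx2'⟩ := hS x' hxy'.1
    obtain ⟨hy1', hy2'⟩ := hS y' hxy'.2
    have hl : l ≠ 0 := by
      rintro rfl
      have hd := det_eq x
      refine hv (Prod.ext ?_ ?_)
      · simp only [Prod.fst_zero]
        linear_combination -v.1 * hd + x.1 1 1 * hx1 - x.1 0 1 * hx2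
      · simp only [Prod.snd_zero]
        linear_combination -v.2 * hd - x.1 1 0 * hx1 + x.1 0 0 * hx2
    have e00 : (x * a * y).1 0 0 = (x' * a * y').1 0 0 := by rw [h]
    have e01 : (x * a * y).1 0 1 = (x' * a * y').1 0 1 := by rw [h]
    have e10 : (x * a * y).1 1 0 = (x' * a * y').1 1 0 := by rw [h]
    have e11 : (x * a * y).1 1 1 = (x' * a * y').1 1 1 := by rw [h]
    simp only [mul_00, mul_01, mul_10, mul_11] at e00 e01 e10 e11
    set w1 := a.1 0 0 * v.1 + a.1 0 1 * v.2 with hw1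
    set w2 := a.1 1 0 * v.1 + a.1 1 1 * v.2 with hw2
    have f1 : x.1 0 0 * w1 + x.1 0 1 * w2 = x'.1 0 0 * w1 + x'.1 0 1 * w2 := by
      apply mul_left_cancel₀ hl
      rw [hw1, hw2]
      linear_combination v.1 * e00 + v.2 * e01
        - (x.1 0 0 * a.1 0 0 + x.1 0 1 * a.1 1 0) * hy1
        - (x.1 0 0 * a.1 0 1 + x.1 0 1 * a.1 1 1) * hy2
        + (x'.1 0 0 * a.1 0 0 + x'.1 0 1 * a.1 1 0) * hy1'
        + (x'.1 0 0 * a.1 0 1 + x'.1 0 1 * a.1 1 1) * hy2'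
    have f2 : x.1 1 0 * w1 + x.1 1 1 * w2 = x'.1 1 0 * w1 + x'.1 1 1 * w2 := by
      apply mul_left_cancel₀ hl
      rw [hw1, hw2]
      linear_combination v.1 * e10 + v.2 * e11
        - (x.1 1 0 * a.1 0 0 + x.1 1 1 * a.1 1 0) * hy1
        - (x.1 1 0 * a.1 0 1 + x.1 1 1 * a.1 1 1) * hy2
        + (x'.1 1 0 * a.1 0 0 + x'.1 1 1 * a.1 1 0) * hy1'
        + (x'.1 1 0 * a.1 0 1 + x'.1 1 1 * a.1 1 1) * hy2'
    have hxx : x = x' := by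
      apply ext_entries <;> apply mul_left_cancel₀ hav
      · linear_combination w2 * hx1 - w2 * hx1' - v.2 * f1
      · linear_combination v.1 * f1 - w1 * hx1 + w1 * hx1'
      · linear_combination w2 * hx2 - w2 * hx2' - v.2 * f2
      · linear_combination v.1 * f2 - w1 * hx2 + w1 * hx2'
    subst hxx
    simp only [Prod.mk.injEq, true_and]
    exact mul_left_cancel h

/-- The linear span of the `k`-fold products of elements of `A`. -/
def powSpan (A : Set SL(2, F)) (k : ℕ) : Submodule F (Matrix (Fin 2) (Fin 2) F) :=
  Submodule.span F ((fun g : SL(2, F) ↦ g.1) '' (A ^ k))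

theorem powSpan_mono {A : Set SL(2, F)} (h1 : 1 ∈ A) (k : ℕ) :
    powSpan A k ≤ powSpan A (k + 1) :=
  Submodule.span_mono (Set.image_mono (Set.pow_subset_pow_right h1 (Nat.le_succ k)))

theorem mul_mem_powSpan {A : Set SL(2, F)} {k : ℕ} {a : SL(2, F)} (ha : a ∈ A)
    {m : Matrix (Fin 2) (Fin 2) F} (hm : m ∈ powSpan A k) : a.1 * m ∈ powSpan A (k + 1) := by
  induction hm using Submodule.span_induction with
  | mem x hx =>
    obtain ⟨g, hg, rfl⟩ := hx
    refine Submodule.subset_span ⟨a * g, ?_, rfl⟩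
    rw [pow_succ']
    exact Set.mul_mem_mul ha hg
  | zero => simp
  | add x y _ _ hx hy => rw [mul_add]; exact add_mem hx hy
  | smul c x _ hx => rw [Matrix.mul_smul]; exact Submodule.smul_mem _ _ hx

/-- Once the span stops growing it is a left ideal containing `1`. -/
theorem powSpan_eq_top_of_eq {A : Set SL(2, F)} (hA : Subgroup.closure A = ⊤) (h1 : 1 ∈ A)
    (hinv : A⁻¹ = A) {k : ℕ} (hk : powSpan A k = powSpan A (k + 1)) : powSpan A k = ⊤ := by
  have key : ∀ g : SL(2, F), (∀ m ∈ powSpan A k, g.1 * m ∈ powSpan A k) ∧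
      (∀ m ∈ powSpan A k, (g⁻¹).1 * m ∈ powSpan A k) := by
    intro g
    have hg : g ∈ Subgroup.closure A := by rw [hA]; trivial
    induction hg using Subgroup.closure_induction with
    | mem x hx =>
      have hx' : x⁻¹ ∈ A := by rw [← hinv]; simpa using hx
      constructor
      · intro m hm
        rw [hk]
        exact mul_mem_powSpan hx hm
      · intro m hm
        rw [hk]
        exact mul_mem_powSpan hx' hm
    | one => simp
    | mul x y _ _ hx hy =>
      constructor
      · intro m hm
        have : (x * y).1 * m = x.1 * (y.1 * m) := by rw [← mul_assoc]; rfl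
        rw [this]
        exact hx.1 _ (hy.1 _ hm)
      · intro m hm
        have : ((x * y)⁻¹).1 * m = (y⁻¹).1 * ((x⁻¹).1 * m) := by
          rw [mul_inv_rev, ← mul_assoc]; rfl
        rw [this]
        exact hy.2 _ (hx.2 _ hm)
    | inv x _ hx =>
      rw [inv_inv]
      exact ⟨hx.2, hx.1⟩
  have hone : (1 : Matrix (Fin 2) (Fin 2) F) ∈ powSpan A k :=
    Submodule.subset_span ⟨(1 : SL(2, F)), Set.one_mem_pow h1, rfl⟩
  have hmem : ∀ g : SL(2, F), g.1 ∈ powSpan A k := fun g ↦ by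
    simpa using (key g).1 1 hone
  have hu := hmem ⟨!![1, 1; 0, 1], by simp [Matrix.det_fin_two_of]⟩
  have hl := hmem ⟨!![1, 0; 1, 1], by simp [Matrix.det_fin_two_of]⟩
  have hw := hmem ⟨!![1, 1; 0, 1] * !![1, 0; 1, 1], by simp [Matrix.det_fin_two_of]⟩
  have e12 := sub_mem hu hone
  have e21 := sub_mem hl hone
  have e11 := sub_mem (sub_mem hw hu) e21
  have e22 := sub_mem hone e11
  rw [eq_top_iff]
  intro m _
  have := add_mem (add_mem (Submodule.smul_mem _ (m 0 0) e11) (Submodule.smul_mem _ (m 0 1) e12))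
    (add_mem (Submodule.smul_mem _ (m 1 0) e21) (Submodule.smul_mem _ (m 1 1) e22))
  convert this
  ext i j
  fin_cases i <;> fin_cases j <;> simp [Matrix.one_fin_two]

theorem powSpan_three {A : Set SL(2, F)} (hA : Subgroup.closure A = ⊤) (h1 : 1 ∈ A)
    (hinv : A⁻¹ = A) : powSpan A 3 = ⊤ := by
  have key : ∀ k, powSpan A k = ⊤ ∨ k + 1 ≤ Module.finrank F (powSpan A k) := by
    intro k
    induction k with
    | zero =>
      right
      rw [zero_add, Nat.one_le_iff_ne_zero]
      have hone : (1 : Matrix (Fin 2) (Fin 2) F) ∈ powSpan A 0 :=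
        Submodule.subset_span ⟨(1 : SL(2, F)), Set.one_mem_pow h1, rfl⟩
      intro h
      rw [Submodule.finrank_eq_zero] at h
      rw [h, Submodule.mem_bot] at hone
      exact one_ne_zero hone
    | succ k ih =>
      rcases ih with ih | ih
      · left
        rw [eq_top_iff, ← ih]
        exact powSpan_mono h1 k
      · by_cases hk : powSpan A k = powSpan A (k + 1)
        · left
          rw [← hk]
          exact powSpan_eq_top_of_eq hA h1 hinv hk
        · right
          have := Submodule.finrank_lt_finrank_of_lt (lt_of_le_of_ne (powSpan_mono h1 k) hk)
          omega
  rcases key 3 with h | h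
  · exact h
  · apply Submodule.eq_top_of_finrank_eq
    apply le_antisymm (Submodule.finrank_le _)
    simpa [Module.finrank_matrix] using h

/-- Since `A ^ 3` spans the matrix algebra, an element of `A` is determined by the traces of its
products with four elements of `A ^ 3`; so not all traces on `A ^ 4` can lie in `{0, 2, -2}`. -/
theorem exists_trace_regular [DecidableEq F] {A : Finset SL(2, F)}
    (hA : Subgroup.closure (A : Set SL(2, F)) = ⊤) (h1 : 1 ∈ A)
    (hinv : A⁻¹ = A) (hcard : 81 < A.card) :
    ∃ g ∈ A ^ 4, g.1.trace ≠ 0 ∧ g.1.trace ^ 2 ≠ 4 := by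
  by_contra! H
  have hspan := powSpan_three hA (A := (A : Set SL(2, F))) (by simpa using h1)
    (by rw [← Finset.coe_inv, hinv])
  obtain ⟨ι, b, hb⟩ : ∃ (ι : Type _) (b : Module.Basis ι F (Matrix (Fin 2) (Fin 2) F)),
      ∀ i, ∃ g ∈ A ^ 3, b i = g.1 := by
    refine ⟨_, Module.Basis.ofSpan (le_of_eq hspan.symm), fun i ↦ ?_⟩
    have := Module.Basis.ofSpan_subset (le_of_eq hspan.symm) ⟨i, rfl⟩
    obtain ⟨g, hg, h⟩ := this
    exact ⟨g, by rw [← Finset.coe_pow] at hg; exact hg, h.symm⟩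
  have : Fintype ι := FiniteDimensional.fintypeBasisIndex b
  classical
  have hc := Module.finrank_eq_card_basis b
  rw [Module.finrank_matrix] at hc
  simp only [Fintype.card_fin, Module.finrank_self] at hc
  refine absurd hcard (not_lt.2 ?_)
  have hT : (Fintype.piFinset (fun _ : ι ↦ ({0, 2, -2} : Finset F)) :
      Finset (ι → F)).card ≤ 81 := by
    rw [Fintype.card_piFinset, Finset.prod_const, Finset.card_univ, ← hc]
    calc _ ≤ 3 ^ (2 * 2 * 1) := Nat.pow_le_pow_left Finset.card_le_three _
      _ = 81 := by norm_num
  refine le_trans ?_ hT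
  refine Finset.card_le_card_of_injOn (fun x i ↦ (x.1 * b i).trace) ?_ ?_
  · intro x hx
    simp only [Finset.mem_coe, Fintype.mem_piFinset] at hx ⊢
    intro i
    obtain ⟨g, hg, hi⟩ := hb i
    rw [hi]
    have hxg : x * g ∈ A ^ 4 := by
      rw [pow_succ' A 3]
      exact Finset.mul_mem_mul hx hg
    have := H _ hxg
    change (x * g).1.trace ∈ _
    generalize (x * g).1.trace = τ at this
    by_cases h0 : τ = 0
    · simp [h0]
    · have h4 := this h0
      have : (τ - 2) * (τ + 2) = 0 := by linear_combination h4
      rcases mul_eq_zero.1 this with h | h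
      · simp [sub_eq_zero.1 h]
      · simp [eq_neg_of_add_eq_zero_left h]
  · intro x _ y _ hxy
    apply Subtype.ext
    rw [Matrix.ext_iff_trace_mul_right]
    intro m
    have : (Matrix.traceLinearMap (Fin 2) F F).comp (LinearMap.mulLeft F x.1) =
        (Matrix.traceLinearMap (Fin 2) F F).comp (LinearMap.mulLeft F y.1) := by
      apply b.ext
      intro i
      simpa using congrFun hxy i
    simpa using LinearMap.congr_fun this m

end SLTwo

/-! ### Pairs and triples of elements of the same trace -/

namespace SLTwo

variable {F : Type*} [Field F]

theorem IsEigen.quadratic {g : SL(2, F)} {v : F × F} {l : F} (hv : v ≠ 0) (hg : IsEigen g v l) :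
    l ^ 2 - g.1.trace * l + 1 = 0 := by
  obtain ⟨h1, h2⟩ := hg
  have hd := det_eq g
  rw [trace_eq]
  have e1 : (l ^ 2 - (g.1 0 0 + g.1 1 1) * l + 1) * v.1 = 0 := by
    linear_combination -v.1 * hd - (l - g.1 1 1) * h1 - g.1 0 1 * h2
  have e2 : (l ^ 2 - (g.1 0 0 + g.1 1 1) * l + 1) * v.2 = 0 := by
    linear_combination -v.2 * hd - (l - g.1 0 0) * h2 - g.1 1 0 * h1
  by_contra hne
  exact hv (Prod.ext ((mul_eq_zero.1 e1).resolve_left hne) ((mul_eq_zero.1 e2).resolve_left hne))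

/-- The kernel of a nonzero nilpotent matrix `(p, q; r, -p)` is a line preserved by every `g`
that is orthogonal to this matrix for the trace form. -/
theorem exists_eigen_of_nilpotent {p q r : F} (hd : p ^ 2 + q * r = 0)
    (hne : ¬ (p = 0 ∧ q = 0 ∧ r = 0)) :
    ∃ v : F × F, v ≠ 0 ∧ p * v.1 + q * v.2 = 0 ∧ r * v.1 - p * v.2 = 0 ∧
      ∀ g : SL(2, F), g.1 0 0 * p + g.1 0 1 * r + g.1 1 0 * q - g.1 1 1 * p = 0 →
        ∃ l, IsEigen g v l := by
  by_cases hr : r = 0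
  · have hp : p = 0 := by
      rw [hr, mul_zero, add_zero] at hd
      exact pow_eq_zero_iff (two_ne_zero) |>.1 hd
    have hq : q ≠ 0 := fun hq ↦ hne ⟨hp, hq, hr⟩
    have hv : ((1, 0) : F × F) ≠ 0 := by simp
    refine ⟨(1, 0), hv, by simp [hp], by simp [hr], fun g hg ↦ exists_isEigen hv ?_⟩
    have : g.1 1 0 * q = 0 := by
      rw [hr, hp] at hg
      linear_combination hg
    simp [(mul_eq_zero.1 this).resolve_right hq]
  · have hv : ((p, r) : F × F) ≠ 0 := by simp [hr]
    refine ⟨(p, r), hv, by linear_combination hd, by ring, fun g hg ↦ exists_isEigen hv ?_⟩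
    dsimp only
    linear_combination g.1 1 0 * hd - r * hg

/-- Distinct elements `x`, `y` of equal trace with `x⁻¹ y` unipotent share an eigenvector. -/
theorem exists_common_eigen {x y : SL(2, F)} (hxy : y.1.trace = x.1.trace)
    (h : (x⁻¹ * y).1.trace = 2) (hne : y ≠ x) :
    ∃ v : F × F, v ≠ 0 ∧ ∃ l, IsEigen x v l ∧ IsEigen y v l := by
  simp only [trace_eq, mul_00, mul_11, inv_00, inv_01, inv_10, inv_11] at h hxy
  have dx := det_eq x
  have dy := det_eq y
  obtain ⟨v, hv, h1, h2, H⟩ := exists_eigen_of_nilpotent (p := y.1 0 0 - x.1 0 0)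
    (q := y.1 0 1 - x.1 0 1) (r := y.1 1 0 - x.1 1 0)
    (by linear_combination h - dy - dx + (y.1 0 0 - x.1 0 0) * hxy) (by
      rintro ⟨e1, e2, e3⟩
      apply hne
      apply ext_entries
      · linear_combination e1
      · linear_combination e2
      · linear_combination e3
      · linear_combination hxy - e1)
  obtain ⟨l, k1, k2⟩ := H x (by linear_combination -h + 2 * dx + x.1 0 0 * hxy)
  refine ⟨v, hv, l, ⟨k1, k2⟩, ?_, ?_⟩
  · linear_combination k1 + h1
  · linear_combination k2 + h2 + v.2 * hxy

/-- The eigenspaces of a non-scalar element are lines. -/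
theorem IsEigen.parallel {x : SL(2, F)} (hx : ¬ IsScalar x) {v w : F × F} {l : F}
    (hv : IsEigen x v l) (hw : IsEigen x w l) : v.1 * w.2 = v.2 * w.1 := by
  obtain ⟨v1, v2⟩ := hv
  obtain ⟨w1, w2⟩ := hw
  by_contra hne
  have hD : v.1 * w.2 - v.2 * w.1 ≠ 0 := sub_ne_zero.2 hne
  apply hx
  have e00 : x.1 0 0 = l := by
    apply mul_left_cancel₀ hD
    linear_combination w.2 * v1 - v.2 * w1
  have e11 : x.1 1 1 = l := by
    apply mul_left_cancel₀ hD
    linear_combination v.1 * w2 - w.1 * v2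
  refine ⟨?_, ?_, e00.trans e11.symm⟩
  · apply mul_left_cancel₀ hD
    linear_combination v.1 * w1 - w.1 * v1
  · apply mul_left_cancel₀ hD
    linear_combination w.2 * v2 - v.2 * w2

theorem IsEigen.of_parallel {y : SL(2, F)} {v w : F × F} {l : F} (hw0 : w ≠ 0)
    (hw : IsEigen y w l) (h : v.1 * w.2 = v.2 * w.1) : IsEigen y v l := by
  obtain ⟨w1, w2⟩ := hw
  by_cases h1 : w.1 = 0
  · have h2 : w.2 ≠ 0 := fun h2 ↦ hw0 (Prod.ext h1 h2)
    constructor <;> apply mul_left_cancel₀ h2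
    · linear_combination v.2 * w1 + (y.1 0 0 - l) * h
    · linear_combination v.2 * w2 + y.1 1 0 * h
  · constructor <;> apply mul_left_cancel₀ h1
    · linear_combination v.1 * w1 - y.1 0 1 * h
    · linear_combination v.1 * w2 - (y.1 1 1 - l) * h

/-- Few elements `y` of `A` have the same trace as `x` and unipotent quotient `x⁻¹ y`. -/
theorem card_near_le [DecidableEq F] {A : Finset SL(2, F)}
    (hA : Subgroup.closure (A : Set SL(2, F)) = ⊤) {x : SL(2, F)} (hx : x.1.trace ^ 2 ≠ 4) :
    (A.filter fun y ↦ y.1.trace = x.1.trace ∧ (x⁻¹ * y).1.trace = 2).card ≤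
      1 + 2 * Nat.sqrt (A ^ 3).card := by
  classical
  have hxs : ¬ IsScalar x := fun h ↦ hx h.trace_sq
  let W : F → Finset SL(2, F) := fun l ↦
    A.filter fun y ↦ ∃ v : F × F, v ≠ 0 ∧ IsEigen x v l ∧ IsEigen y v l
  have hW : ∀ l, (W l).card ≤ Nat.sqrt (A ^ 3).card := by
    intro l
    rcases (W l).eq_empty_or_nonempty with h | ⟨y, hy⟩
    · simp [h]
    · obtain ⟨-, v, hv0, hv, -⟩ := Finset.mem_filter.1 hy
      rw [Nat.le_sqrt']
      refine card_isEigen_sq_le hA hv0 l (Finset.filter_subset _ _) ?_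
      intro z hz
      obtain ⟨-, w, hw0, hw, hzw⟩ := Finset.mem_filter.1 hz
      exact hzw.of_parallel hw0 (hv.parallel hxs hw)
  have hroot : ∃ l₀, ∀ l v, v ≠ 0 → IsEigen x v l → l = l₀ ∨ l = x.1.trace - l₀ := by
    by_cases h : ∃ l v, v ≠ 0 ∧ IsEigen x v l
    · obtain ⟨l₀, v, hv0, hv⟩ := h
      refine ⟨l₀, fun l w hw0 hw ↦ ?_⟩
      have h1 := hv.quadratic hv0
      have h2 := hw.quadratic hw0
      have : (l - l₀) * (l + l₀ - x.1.trace) = 0 := by linear_combination h2 - h1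
      rcases mul_eq_zero.1 this with h | h
      · left; linear_combination h
      · right; linear_combination h
    · exact ⟨0, fun l v hv0 hv ↦ absurd ⟨l, v, hv0, hv⟩ h⟩
  obtain ⟨l₀, hl₀⟩ := hroot
  calc _ ≤ ({x} ∪ (W l₀ ∪ W (x.1.trace - l₀))).card := by
        refine Finset.card_le_card fun y hy ↦ ?_
        obtain ⟨hyA, h1, h2⟩ := Finset.mem_filter.1 hy
        by_cases hyx : y = x
        · simp [hyx]
        · obtain ⟨v, hv0, l, hl, hl'⟩ := exists_common_eigen h1 h2 hyx
          have hyW : y ∈ W l := Finset.mem_filter.2 ⟨hyA, v, hv0, hl, hl'⟩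
          rcases hl₀ l v hv0 hl with rfl | rfl
          · simp [hyW]
          · simp [hyW]
    _ ≤ 1 + (Nat.sqrt (A ^ 3).card + Nat.sqrt (A ^ 3).card) := by
        refine (Finset.card_union_le _ _).trans (add_le_add (by simp) ?_)
        exact (Finset.card_union_le _ _).trans (add_le_add (hW _) (hW _))
    _ = _ := by ring

/-- Elements `x`, `y` of trace `t` with a common eigenvector have `tr (x y) ∈ {2, t² - 2}`. -/
theorem trace_mul_of_common_eigen {x y : SL(2, F)} {t : F} (hx : x.1.trace = t)
    (hy : y.1.trace = t) {v : F × F} (hv : v ≠ 0) {l m : F} (hl : IsEigen x v l)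
    (hm : IsEigen y v m) : (x * y).1.trace = 2 ∨ (x * y).1.trace = t ^ 2 - 2 := by
  have h1 := hl.quadratic hv
  have h2 := hm.quadratic hv
  have h3 := (hl.mul hm).quadratic hv
  rw [hx] at h1
  rw [hy] at h2
  have h0 : l ≠ 0 := by rintro rfl; simp at h1
  have : (m - l) * (m + l - t) = 0 := by linear_combination h2 - h1
  rcases mul_eq_zero.1 this with h | h
  · right
    have h : m = l := by linear_combination h
    subst h
    have : m ^ 2 ≠ 0 := pow_ne_zero 2 h0
    apply mul_left_cancel₀ this
    linear_combination -h3 + (m ^ 2 + t * m + 1) * h1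
  · left
    have hm' : m = t - l := by linear_combination h
    have : m * l = 1 := by rw [hm']; linear_combination -h1
    rw [this] at h3
    linear_combination -h3

/-- If `x`, `y`, `z` have trace `t ≠ 0`, `x y` does not have trace `2`, and `z ∉ {y, x⁻¹}`,
then `x⁻¹, y, z` are linearly independent; this is expressed through the trace-zero parts of
`x y` and `x z` not being parallel. -/
theorem not_parallel_of_trace_ne {x y z : SL(2, F)} {t : F} (ht : t ≠ 0) (hx : x.1.trace = t)
    (hy : y.1.trace = t) (hz : z.1.trace = t) (hxy : (x * y).1.trace ≠ 2) (hzy : z ≠ y)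
    (hzx : z ≠ x⁻¹) {g h : SL(2, F)} (hg : g = x * y) (hh : h = x * z)
    (e1 : (g.1 0 0 - g.1 1 1) * h.1 0 1 = (h.1 0 0 - h.1 1 1) * g.1 0 1)
    (e2 : (g.1 0 0 - g.1 1 1) * h.1 1 0 = (h.1 0 0 - h.1 1 1) * g.1 1 0)
    (e3 : g.1 0 1 * h.1 1 0 = h.1 0 1 * g.1 1 0) : False := by
  have hgs : ¬ IsScalar g := by
    rintro ⟨s1, s2, s3⟩
    have hgd := det_eq g
    rw [s1, ← s3] at hgd
    have : (g.1 0 0 - 1) * (g.1 0 0 + 1) = 0 := by linear_combination hgd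
    rw [← hg, trace_eq, ← s3] at hxy
    rcases mul_eq_zero.1 this with h | h
    · exact hxy (by linear_combination 2 * h)
    · have hyx : y = x⁻¹ * g := by rw [hg]; group
      have : y.1.trace = - t := by
        rw [hyx, trace_eq]
        rw [trace_eq] at hx
        simp only [mul_00, mul_11, inv_00, inv_01, inv_10, inv_11, s1, s2, ← s3]
        linear_combination (x.1 0 0 + x.1 1 1) * h - hx
      have h2 : (2 : F) * t = 0 := by linear_combination this - hy
      have h2 := (mul_eq_zero.1 h2).resolve_right ht
      exact hxy (by linear_combination 2 * h - 2 * h2)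
  -- `h = c + k g`
  obtain ⟨c, k, k1, k2, k3, k4⟩ := exists_of_commute (x := g) (y := h) hgs (by
    apply ext_entries <;> simp only [mul_00, mul_01, mul_10, mul_11]
    · linear_combination -e3
    · linear_combination -e1
    · linear_combination e2
    · linear_combination e3)
  have hyg : y = x⁻¹ * g := by rw [hg]; group
  have hzh : z = x⁻¹ * h := by rw [hh]; group
  have z00 : z.1 0 0 = k * y.1 0 0 + c * x.1 1 1 := by
    rw [hyg, hzh]; simp only [mul_00, inv_00, inv_01]; rw [k1, k3]; ring
  have z01 : z.1 0 1 = k * y.1 0 1 - c * x.1 0 1 := by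
    rw [hyg, hzh]; simp only [mul_01, inv_00, inv_01]; rw [k2, k4]; ring
  have z10 : z.1 1 0 = k * y.1 1 0 - c * x.1 1 0 := by
    rw [hyg, hzh]; simp only [mul_10, inv_10, inv_11]; rw [k1, k3]; ring
  have z11 : z.1 1 1 = k * y.1 1 1 + c * x.1 0 0 := by
    rw [hyg, hzh]; simp only [mul_11, inv_10, inv_11]; rw [k2, k4]; ring
  rw [trace_eq] at hx hy hz
  have hk : k = 1 - c := by
    apply mul_left_cancel₀ ht
    linear_combination hz - k * hy - c * hx - z00 - z11
  subst hk
  have dx := det_eq x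
  have dy := det_eq y
  have dz := det_eq z
  rw [z00, z01, z10, z11] at dz
  simp only [trace_eq, mul_00, mul_11] at hxy
  have key : c * (1 - c) * (x.1 0 0 * y.1 0 0 + x.1 0 1 * y.1 1 0 +
      (x.1 1 0 * y.1 0 1 + x.1 1 1 * y.1 1 1) - 2) = 0 := by
    linear_combination dz - (1 - c) ^ 2 * dy - c ^ 2 * dx
  have hc := (mul_eq_zero.1 key).resolve_right (sub_ne_zero.2 hxy)
  rcases mul_eq_zero.1 hc with hc | hc
  · apply hzy
    apply ext_entries
    · rw [z00, hc]; ring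
    · rw [z01, hc]; ring
    · rw [z10, hc]; ring
    · rw [z11, hc]; ring
  · have hc : c = 1 := by linear_combination -hc
    apply hzx
    apply ext_entries <;> simp only [inv_00, inv_01, inv_10, inv_11]
    · rw [z00, hc]; ring
    · rw [z01, hc]; ring
    · rw [z10, hc]; ring
    · rw [z11, hc]; ring

/-- Two vectors orthogonal to two independent vectors of `F³` are parallel. -/
theorem parallel_of_orthogonal {a b c a' b' c' p q r p' q' r' : F}
    (h1 : a * p + b * q + c * r = 0) (h2 : a' * p + b' * q + c' * r = 0)
    (h3 : a * p' + b * q' + c * r' = 0) (h4 : a' * p' + b' * q' + c' * r' = 0)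
    (h : ¬ (p * q' = q * p' ∧ p * r' = r * p' ∧ q * r' = r * q')) :
    a * b' = a' * b ∧ a * c' = a' * c ∧ b * c' = b' * c := by
  by_cases hx : p * q' = q * p'
  · by_cases hy : p * r' = r * p'
    · have hz : q * r' - r * q' ≠ 0 := fun hz ↦ h ⟨hx, hy, sub_eq_zero.1 hz⟩
      have b0 : b = a * (r * p' - p * r') / (q * r' - r * q') := by
        rw [eq_div_iff hz]
        linear_combination r' * h1 - r * h3
      have c0 : c = a * (p * q' - q * p') / (q * r' - r * q') := by
        rw [eq_div_iff hz]
        linear_combination q * h3 - q' * h1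
      have b0' : b' = a' * (r * p' - p * r') / (q * r' - r * q') := by
        rw [eq_div_iff hz]
        linear_combination r' * h2 - r * h4
      have c0' : c' = a' * (p * q' - q * p') / (q * r' - r * q') := by
        rw [eq_div_iff hz]
        linear_combination q * h4 - q' * h2
      rw [b0, c0, b0', c0']
      refine ⟨?_, ?_, ?_⟩ <;> field_simp
    · have hz : p * r' - r * p' ≠ 0 := sub_ne_zero.2 hy
      have a0 : a = b * (r * q' - q * r') / (p * r' - r * p') := by
        rw [eq_div_iff hz]
        linear_combination r' * h1 - r * h3
      have c0 : c = b * (q * p' - p * q') / (p * r' - r * p') := by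
        rw [eq_div_iff hz]
        linear_combination p * h3 - p' * h1
      have a0' : a' = b' * (r * q' - q * r') / (p * r' - r * p') := by
        rw [eq_div_iff hz]
        linear_combination r' * h2 - r * h4
      have c0' : c' = b' * (q * p' - p * q') / (p * r' - r * p') := by
        rw [eq_div_iff hz]
        linear_combination p * h4 - p' * h2
      rw [a0, c0, a0', c0']
      refine ⟨?_, ?_, ?_⟩ <;> field_simp
  · have hz : p * q' - q * p' ≠ 0 := sub_ne_zero.2 hx
    have a0 : a = c * (q * r' - r * q') / (p * q' - q * p') := by
      rw [eq_div_iff hz]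
      linear_combination q' * h1 - q * h3
    have b0 : b = c * (r * p' - p * r') / (p * q' - q * p') := by
      rw [eq_div_iff hz]
      linear_combination p * h3 - p' * h1
    have a0' : a' = c' * (q * r' - r * q') / (p * q' - q * p') := by
      rw [eq_div_iff hz]
      linear_combination q' * h2 - q * h4
    have b0' : b' = c' * (r * p' - p * r') / (p * q' - q * p') := by
      rw [eq_div_iff hz]
      linear_combination p * h4 - p' * h2
    rw [a0, b0, a0', b0']
    refine ⟨?_, ?_, ?_⟩ <;> field_simp

end SLTwo

/-! ### The dimensional estimate for conjugacy classes -/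

namespace SLTwo

variable {F : Type*} [Field F]

/-- Triples of elements of trace `t` on which `(x, y, z) ↦ (x y, x z)` is at most two-to-one.
The conditions on `tr (x y)` say that `x` and `y` have no common eigenvector, even over an
extension of `F`; together with `z ∉ {y, x⁻¹}` they make `x⁻¹, y, z` linearly independent. -/
structure GoodTriple (t : F) (x y z : SL(2, F)) : Prop where
  hx : x.1.trace = t
  hy : y.1.trace = t
  hz : z.1.trace = t
  ne_two : (x * y).1.trace ≠ 2
  ne_sq : (x * y).1.trace ≠ t ^ 2 - 2
  ne_y : z ≠ y
  ne_inv : z ≠ x⁻¹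

/-- If `x y = x' y'` with equal traces, then `x' - x` (of trace zero) is orthogonal to `x y` for the
trace form. -/
theorem GoodTriple.orthogonal {x x' y y' g : SL(2, F)} (hx : x'.1.trace = x.1.trace)
    (hy : y'.1.trace = y.1.trace) (hg : g = x * y) (hg' : g = x' * y') :
    (g.1 0 0 - g.1 1 1) * (x'.1 0 0 - x.1 0 0) + g.1 1 0 * (x'.1 0 1 - x.1 0 1) +
      g.1 0 1 * (x'.1 1 0 - x.1 1 0) = 0 := by
  have h1 : y = x⁻¹ * g := by rw [hg]; group
  have h2 : y' = x'⁻¹ * g := by rw [hg']; group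
  rw [h1, h2] at hy
  simp only [trace_eq, mul_00, mul_11, inv_00, inv_01, inv_10, inv_11] at hx hy
  linear_combination -hy + g.1 0 0 * hx

/-- A nonzero nilpotent `(p, q; r, -p)` cannot be orthogonal to both `x` and `x y`
for a good triple. -/
theorem GoodTriple.not_nilpotent {t : F} {x y z : SL(2, F)} (h : GoodTriple t x y z) {p q r : F}
    (hd : p ^ 2 + q * r = 0) (hne : ¬ (p = 0 ∧ q = 0 ∧ r = 0))
    (h1 : x.1 0 0 * p + x.1 0 1 * r + x.1 1 0 * q - x.1 1 1 * p = 0)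
    (h2 : ((x * y).1 0 0 - (x * y).1 1 1) * p + (x * y).1 1 0 * q + (x * y).1 0 1 * r = 0) :
    False := by
  obtain ⟨v, hv, -, -, H⟩ := exists_eigen_of_nilpotent hd hne
  obtain ⟨l, hl⟩ := H x h1
  obtain ⟨m, hm⟩ := H (x * y) (by linear_combination h2)
  have hy := (hl.inv hv).mul hm
  rw [inv_mul_cancel_left] at hy
  rcases trace_mul_of_common_eigen h.hx h.hy hv hl hy with h' | h'
  · exact h.ne_two h'
  · exact h.ne_sq h'

/-- The fibres of `(x, y, z) ↦ (x y, x z)` on good triples have at most two elements. -/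
theorem GoodTriple.fibre {t : F} (ht : t ≠ 0) {x y z x' y' z' x'' y'' z'' : SL(2, F)}
    (h : GoodTriple t x y z) (h' : GoodTriple t x' y' z') (h'' : GoodTriple t x'' y'' z'')
    (e1 : x' * y' = x * y) (e2 : x' * z' = x * z) (f1 : x'' * y'' = x * y)
    (f2 : x'' * z'' = x * z) (n1 : x' ≠ x) (n2 : x'' ≠ x) : x' = x'' := by
  have o1 := orthogonal (h'.hx.trans h.hx.symm) (h'.hy.trans h.hy.symm) rfl e1.symm
  have o2 := orthogonal (h'.hx.trans h.hx.symm) (h'.hz.trans h.hz.symm) rfl e2.symm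
  have o3 := orthogonal (h''.hx.trans h.hx.symm) (h''.hy.trans h.hy.symm) rfl f1.symm
  have o4 := orthogonal (h''.hx.trans h.hx.symm) (h''.hz.trans h.hz.symm) rfl f2.symm
  have tx := h.hx
  have tx' := h'.hx
  have tx'' := h''.hx
  have dx := det_eq x
  have dx' := det_eq x'
  have dx'' := det_eq x''
  rw [trace_eq] at tx tx' tx''
  set g := x * y with hg
  have e11' : x'.1 1 1 = x.1 1 1 - (x'.1 0 0 - x.1 0 0) := by linear_combination tx' - tx
  have e11'' : x''.1 1 1 = x.1 1 1 - (x''.1 0 0 - x.1 0 0) := by linear_combination tx'' - tx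
  rw [e11'] at dx'
  rw [e11''] at dx''
  obtain ⟨p, hp⟩ : ∃ p, p = x'.1 0 0 - x.1 0 0 := ⟨_, rfl⟩
  obtain ⟨q, hq⟩ : ∃ p, p = x'.1 0 1 - x.1 0 1 := ⟨_, rfl⟩
  obtain ⟨r, hr⟩ : ∃ p, p = x'.1 1 0 - x.1 1 0 := ⟨_, rfl⟩
  obtain ⟨p', hp'⟩ : ∃ p, p = x''.1 0 0 - x.1 0 0 := ⟨_, rfl⟩
  obtain ⟨q', hq'⟩ : ∃ p, p = x''.1 0 1 - x.1 0 1 := ⟨_, rfl⟩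
  obtain ⟨r', hr'⟩ : ∃ p, p = x''.1 1 0 - x.1 1 0 := ⟨_, rfl⟩
  rw [← hp, ← hq, ← hr] at o1 o2
  rw [← hp', ← hq', ← hr'] at o3 o4
  -- `det (x + d) = det x` for `d = x' - x` and for `d = x'' - x`
  have D1 : -p ^ 2 - q * r + p * (x.1 1 1 - x.1 0 0) - q * x.1 1 0 - r * x.1 0 1 = 0 := by
    rw [hp, hq, hr]; linear_combination dx' - dx
  have D2 : -p' ^ 2 - q' * r' + p' * (x.1 1 1 - x.1 0 0) - q' * x.1 1 0 - r' * x.1 0 1 = 0 := by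
    rw [hp', hq', hr']; linear_combination dx'' - dx
  have hne : ¬ (p = 0 ∧ q = 0 ∧ r = 0) := by
    rintro ⟨rfl, rfl, rfl⟩
    apply n1
    apply ext_entries
    · linear_combination -hp
    · linear_combination -hq
    · linear_combination -hr
    · linear_combination e11' + hp
  have hne' : ¬ (p' = 0 ∧ q' = 0 ∧ r' = 0) := by
    rintro ⟨rfl, rfl, rfl⟩
    apply n2
    apply ext_entries
    · linear_combination -hp'
    · linear_combination -hq'
    · linear_combination -hr'
    · linear_combination e11'' + hp'
  have hpar : p * q' = q * p' ∧ p * r' = r * p' ∧ q * r' = r * q' := by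
    by_contra hcon
    obtain ⟨k1, k2, k3⟩ := parallel_of_orthogonal o1 o2 o3 o4 hcon
    refine not_parallel_of_trace_ne ht h.hx h.hy h.hz h.ne_two h.ne_y h.ne_inv hg rfl k2 k1 ?_
    linear_combination -k3
  -- `x''` lies on the line through `x` and `x'`, which meets the quadric `det = 1` in two points
  -- unless its direction is nilpotent
  obtain ⟨s, s1, s2, s3⟩ : ∃ s, p' = s * p ∧ q' = s * q ∧ r' = s * r := by
    obtain ⟨k1, k2, k3⟩ := hpar
    by_cases a1 : p = 0
    · by_cases a2 : q = 0
      · have a3 : r ≠ 0 := fun a3 ↦ hne ⟨a1, a2, a3⟩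
        refine ⟨r' / r, ?_, ?_, ?_⟩ <;> field_simp
        · linear_combination -k2
        · linear_combination -k3
      · refine ⟨q' / q, ?_, ?_, ?_⟩ <;> field_simp
        · linear_combination -k1
        · linear_combination k3
    · refine ⟨p' / p, ?_, ?_, ?_⟩ <;> field_simp
      · linear_combination k1
      · linear_combination k2
  have hs : s ≠ 0 := by
    rintro rfl
    exact hne' ⟨by rw [s1, zero_mul], by rw [s2, zero_mul], by rw [s3, zero_mul]⟩
  rw [s1, s2, s3] at D2
  have D3 : (s - 1) * (p ^ 2 + q * r) = 0 := by
    apply mul_left_cancel₀ hs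
    linear_combination s * D1 - D2
  rcases mul_eq_zero.1 D3 with hs1 | hD
  · have hs1 : s = 1 := by linear_combination hs1
    rw [hs1, one_mul] at s1 s2 s3
    apply ext_entries
    · linear_combination hp' - hp - s1
    · linear_combination hq' - hq - s2
    · linear_combination hr' - hr - s3
    · linear_combination e11' - e11'' + s1 + hp - hp'
  · exact (h.not_nilpotent hD hne (by linear_combination -D1 - hD) o1).elim

/-- The dimensional estimate for the classes `tr = t`, which have dimension two out of three. The map
`(x, y, z) ↦ (x y, x z)` sends the triples of `S = A ∩ {tr = t}` to `A ^ 2 × A ^ 2`, is at most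
two-to-one on good triples, and the other triples are `O(|A ^ 3| ^ (1 / 2) |S| ^ 2)` in number. -/
theorem card_trace_pow_three_le [DecidableEq F] {A : Finset SL(2, F)}
    (hA : Subgroup.closure (A : Set SL(2, F)) = ⊤) (hne : A.Nonempty) {t : F} (ht : t ≠ 0)
    (ht4 : t ^ 2 ≠ 4) :
    (A.filter fun x ↦ x.1.trace = t).card ^ 3 ≤ 4096 * (A ^ 3).card ^ 2 := by
  classical
  obtain ⟨S, hS⟩ : ∃ S, S = A.filter fun x ↦ x.1.trace = t := ⟨_, rfl⟩
  rw [← hS]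
  have hSA : S ⊆ A := hS ▸ Finset.filter_subset _ _
  have hSt : ∀ x ∈ S, x.1.trace = t := by
    intro x hx
    rw [hS] at hx
    exact (Finset.mem_filter.1 hx).2
  set M := Nat.sqrt (A ^ 3).card with hM
  have hN0 : 0 < (A ^ 3).card := hne.pow.card_pos
  have hM1 : 1 ≤ M := by rw [hM, Nat.le_sqrt']; omega
  have hMN : M ^ 2 ≤ (A ^ 3).card := Nat.sqrt_le' _
  have hA2 : (A ^ 2).card ≤ (A ^ 3).card := hne.card_pow_mono (by norm_num)
  have htri : (S ×ˢ S ×ˢ S).card = S.card ^ 3 := by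
    simp only [Finset.card_product]; ring
  have hcover : S ×ˢ S ×ˢ S ⊆
      ((S ×ˢ S ×ˢ S).filter fun p ↦ GoodTriple t p.1 p.2.1 p.2.2) ∪
      (((S ×ˢ S ×ˢ S).filter fun p ↦ (p.1 * p.2.1).1.trace = 2) ∪
      (((S ×ˢ S ×ˢ S).filter fun p ↦ (p.1 * p.2.1).1.trace = t ^ 2 - 2) ∪
      ((S ×ˢ S ×ˢ S).filter fun p ↦ p.2.2 = p.2.1 ∨ p.2.2 = p.1⁻¹))) := by
    rintro ⟨x, y, z⟩ hp
    have hp' := hp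
    simp only [Finset.mem_product] at hp'
    simp only [Finset.mem_union, Finset.mem_filter, hp, true_and]
    by_contra! hcon
    exact hcon.1 ⟨hSt x hp'.1, hSt y hp'.2.1, hSt z hp'.2.2, hcon.2.1, hcon.2.2.1,
      hcon.2.2.2.1, hcon.2.2.2.2⟩
  have hgood : ((S ×ˢ S ×ˢ S).filter fun p ↦ GoodTriple t p.1 p.2.1 p.2.2).card ≤
      2 * ((A ^ 2) ×ˢ (A ^ 2)).card := by
    refine Finset.card_le_mul_card_image_of_maps_to
      (f := fun p : SL(2, F) × SL(2, F) × SL(2, F) ↦ (p.1 * p.2.1, p.1 * p.2.2)) ?_ 2 ?_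
    · rintro ⟨x, y, z⟩ hp
      simp only [Finset.mem_filter, Finset.mem_product] at hp ⊢
      rw [sq]
      exact ⟨Finset.mul_mem_mul (hSA hp.1.1) (hSA hp.1.2.1),
        Finset.mul_mem_mul (hSA hp.1.1) (hSA hp.1.2.2)⟩
    · rintro ⟨g, h⟩ -
      by_contra! hcon
      rw [Finset.two_lt_card] at hcon
      obtain ⟨⟨x, y, z⟩, ha, ⟨x', y', z'⟩, hb, ⟨x'', y'', z''⟩, hc, hab, hac, hbc⟩ := hcon
      simp only [Finset.mem_filter, Prod.mk.injEq] at ha hb hc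
      obtain ⟨⟨-, ga⟩, a1, a2⟩ := ha
      obtain ⟨⟨-, gb⟩, b1, b2⟩ := hb
      obtain ⟨⟨-, gc⟩, c1, c2⟩ := hc
      have nab : x' ≠ x := by
        rintro rfl
        apply hab
        rw [mul_left_cancel (a1.trans b1.symm), mul_left_cancel (a2.trans b2.symm)]
      have nac : x'' ≠ x := by
        rintro rfl
        apply hac
        rw [mul_left_cancel (a1.trans c1.symm), mul_left_cancel (a2.trans c2.symm)]
      have := ga.fibre ht gb gc (b1.trans a1.symm) (b2.trans a2.symm) (c1.trans a1.symm)
        (c2.trans a2.symm) nab nac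
      subst this
      apply hbc
      rw [mul_left_cancel (b1.trans c1.symm), mul_left_cancel (b2.trans c2.symm)]
  have hnear : ∀ x : SL(2, F), x.1.trace = t →
      (S.filter fun y ↦ (x⁻¹ * y).1.trace = 2).card ≤ 1 + 2 * M := by
    intro x hx
    refine le_trans (Finset.card_le_card ?_) (card_near_le hA (x := x) (by rwa [hx]))
    intro y hy
    simp only [Finset.mem_filter] at hy ⊢
    exact ⟨hSA hy.1, (hSt y hy.1).trans hx.symm, hy.2⟩
  have hbad : ∀ (P : SL(2, F) → SL(2, F) → Prop) [∀ x y, Decidable (P x y)], (∀ x ∈ S, (S.filter fun y ↦ P x y).card ≤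
      1 + 2 * M) → ((S ×ˢ S ×ˢ S).filter fun p ↦ P p.1 p.2.1).card ≤
        (1 + 2 * M) * (S ×ˢ S).card := by
    intro P _ hP
    refine Finset.card_le_mul_card_image_of_maps_to
      (f := fun p : SL(2, F) × SL(2, F) × SL(2, F) ↦ (p.1, p.2.2)) ?_ _ ?_
    · rintro ⟨x, y, z⟩ hp
      simp only [Finset.mem_filter, Finset.mem_product] at hp ⊢
      exact ⟨hp.1.1, hp.1.2.2⟩
    · rintro ⟨x, z⟩ hxz
      simp only [Finset.mem_product] at hxz
      refine le_trans (Finset.card_le_card_of_injOn (fun p ↦ p.2.1) ?_ ?_) (hP x hxz.1)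
      · rintro ⟨a, b, c⟩ hp
        simp only [Finset.coe_filter, Finset.mem_filter, Finset.mem_product, Prod.mk.injEq,
          Set.mem_ofPred_eq] at hp ⊢
        obtain ⟨⟨⟨-, hb, -⟩, hP⟩, rfl, rfl⟩ := hp
        exact ⟨hb, hP⟩
      · rintro ⟨a, b, c⟩ hp ⟨a', b', c'⟩ hp' heq
        simp only [Finset.coe_filter, Finset.mem_filter, Prod.mk.injEq,
          Set.mem_ofPred_eq] at hp hp' heq
        simp [hp.2.1, hp.2.2, hp'.2.1, hp'.2.2, heq]
  have hbad1 := hbad (fun x y ↦ (x * y).1.trace = 2) (by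
    intro x hx
    have htr : (x⁻¹).1.trace = t := by
      rw [← hSt x hx, trace_eq, trace_eq, inv_00, inv_11, add_comm]
    simpa using hnear x⁻¹ htr)
  have hbad2 := hbad (fun x y ↦ (x * y).1.trace = t ^ 2 - 2) (by
    intro x hx
    refine le_trans (Finset.card_le_card ?_) (hnear x (hSt x hx))
    intro y hy
    simp only [Finset.mem_filter] at hy ⊢
    refine ⟨hy.1, ?_⟩
    have h1 := hSt x hx
    have h2 := hSt y hy.1
    have h3 := hy.2
    simp only [trace_eq, mul_00, mul_11, inv_00, inv_01, inv_10, inv_11] at h1 h2 h3 ⊢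
    linear_combination (y.1 0 0 + y.1 1 1) * h1 + t * h2 - h3)
  have hbad3 : ((S ×ˢ S ×ˢ S).filter fun p ↦ p.2.2 = p.2.1 ∨ p.2.2 = p.1⁻¹).card ≤
      2 * (S ×ˢ S).card := by
    refine Finset.card_le_mul_card_image_of_maps_to
      (f := fun p : SL(2, F) × SL(2, F) × SL(2, F) ↦ (p.1, p.2.1)) ?_ _ ?_
    · rintro ⟨x, y, z⟩ hp
      simp only [Finset.mem_filter, Finset.mem_product] at hp ⊢
      exact ⟨hp.1.1, hp.1.2.1⟩
    · rintro ⟨x, y⟩ -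
      refine le_trans (Finset.card_le_card (t := {(x, y, y), (x, y, x⁻¹)}) ?_) Finset.card_le_two
      rintro ⟨a, b, c⟩ hp
      simp only [Finset.mem_filter, Prod.mk.injEq, Finset.mem_insert, Finset.mem_singleton]
        at hp ⊢
      obtain ⟨⟨-, h⟩, rfl, rfl⟩ := hp
      simpa using h
  have hfin : S.card ^ 3 ≤ 2 * (A ^ 3).card ^ 2 + (4 + 4 * M) * S.card ^ 2 := by
    rw [← htri]
    refine (Finset.card_le_card hcover).trans ((Finset.card_union_le _ _).trans ?_)
    have h1 := Finset.card_union_le ((S ×ˢ S ×ˢ S).filter fun p ↦ (p.1 * p.2.1).1.trace = 2)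
      (((S ×ˢ S ×ˢ S).filter fun p ↦ (p.1 * p.2.1).1.trace = t ^ 2 - 2) ∪
      ((S ×ˢ S ×ˢ S).filter fun p ↦ p.2.2 = p.2.1 ∨ p.2.2 = p.1⁻¹))
    have h2 := Finset.card_union_le
      ((S ×ˢ S ×ˢ S).filter fun p ↦ (p.1 * p.2.1).1.trace = t ^ 2 - 2)
      ((S ×ˢ S ×ˢ S).filter fun p ↦ p.2.2 = p.2.1 ∨ p.2.2 = p.1⁻¹)
    have h3 : ((A ^ 2) ×ˢ (A ^ 2)).card ≤ (A ^ 3).card ^ 2 := by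
      rw [Finset.card_product]
      exact (Nat.mul_le_mul hA2 hA2).trans_eq (sq _).symm
    have h4 : (S ×ˢ S).card = S.card ^ 2 := by rw [Finset.card_product, sq]
    rw [h4] at hbad1 hbad2 hbad3
    have h5 : (4 + 4 * M) * S.card ^ 2 = (1 + 2 * M) * S.card ^ 2 + (1 + 2 * M) * S.card ^ 2 +
      2 * S.card ^ 2 := by ring
    rw [h5]
    linarith
  by_cases hsm : S.card ≤ 16 * M
  · calc S.card ^ 3 ≤ (16 * M) ^ 3 := Nat.pow_le_pow_left hsm 3
      _ = 4096 * (M ^ 2 * M) := by ring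
      _ ≤ 4096 * (M ^ 2 * M ^ 2) := by
        gcongr
        exact Nat.le_self_pow (by norm_num) M
      _ ≤ 4096 * ((A ^ 3).card * (A ^ 3).card) := by gcongr
      _ = _ := by ring
  · push Not at hsm
    have h6 : 2 * (4 + 4 * M) ≤ S.card := by omega
    have h7 : 2 * ((4 + 4 * M) * S.card ^ 2) ≤ S.card ^ 3 := by
      calc 2 * ((4 + 4 * M) * S.card ^ 2) = 2 * (4 + 4 * M) * S.card ^ 2 := by ring
        _ ≤ S.card * S.card ^ 2 := by gcongr
        _ = _ := by ring
    nlinarith [Nat.zero_le ((A ^ 3).card ^ 2)]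

end SLTwo

/-! ### Conjugates of a torus -/

namespace SLTwo

variable {F : Type*} [Field F]

/-- The centralizer of a non-scalar element is commutative. -/
theorem commute_of_commute {x y z : SL(2, F)} (hx : ¬ IsScalar x) (hy : y * x = x * y)
    (hz : z * x = x * z) : y * z = z * y := by
  obtain ⟨a, b, h1, h2, h3, h4⟩ := exists_of_commute hx hy
  obtain ⟨c, d, k1, k2, k3, k4⟩ := exists_of_commute hx hz
  apply ext_entries <;> simp only [mul_00, mul_01, mul_10, mul_11, h1, h2, h3, h4, k1, k2, k3, k4]
    <;> ring

section
variable [DecidableEq F]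

/-- A torus contains at most two elements of a given trace. -/
theorem card_commute_trace_le {x : SL(2, F)} (hx : x.1.trace ^ 2 ≠ 4) (t : F)
    (Y : Finset SL(2, F)) : (Y.filter fun y ↦ y * x = x * y ∧ y.1.trace = t).card ≤ 2 := by
  rcases (Y.filter fun y ↦ y * x = x * y ∧ y.1.trace = t).eq_empty_or_nonempty with h | ⟨y, hy⟩
  · simp [h]
  · refine (Finset.card_le_card (t := {y, y⁻¹}) ?_).trans Finset.card_le_two
    intro z hz
    simp only [Finset.mem_filter, Finset.mem_insert, Finset.mem_singleton] at hy hz ⊢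
    exact eq_or_eq_inv_of_commute hx hy.2.1 hz.2.1 (hz.2.2.trans hy.2.2.symm)

/-- Orbit-stabilizer for a set: a class meeting `B ^ 6` in few elements has large centralizers. -/
theorem card_le_card_commute_mul {B : Finset SL(2, F)} (hinv : B⁻¹ = B) {g : SL(2, F)}
    (hg : g ∈ B ^ 4) : B.card ≤ ((B ^ 2).filter fun y ↦ y * g = g * y).card *
      ((B ^ 6).filter fun x ↦ x.1.trace = g.1.trace).card := by
  refine Finset.card_le_mul_card_image_of_maps_to (f := fun b ↦ b * g * b⁻¹) ?_ _ ?_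
  · intro b hb
    simp only [Finset.mem_filter]
    refine ⟨?_, trace_conj g b⟩
    have : B ^ 6 = B * B ^ 4 * B := by rw [← pow_succ', ← pow_succ]
    rw [this]
    refine Finset.mul_mem_mul (Finset.mul_mem_mul hb hg) ?_
    rw [← hinv]
    exact Finset.inv_mem_inv hb
  · intro c _
    rcases (B.filter fun b ↦ b * g * b⁻¹ = c).eq_empty_or_nonempty with h | ⟨b, hb⟩
    · simp [h]
    · refine Finset.card_le_card_of_injOn (fun a ↦ b⁻¹ * a) ?_ (by intro a _ a' _; simp)
      intro a ha
      simp only [Finset.coe_filter, Finset.mem_filter, Set.mem_ofPred_eq] at ha hb ⊢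
      constructor
      · rw [sq]
        refine Finset.mul_mem_mul ?_ ha.1
        rw [← hinv]
        exact Finset.inv_mem_inv hb.1
      · have h1 := ha.2.trans hb.2.symm
        have h2 : a * g = b * g * b⁻¹ * a := by rw [← h1]; group
        rw [mul_assoc, h2]
        group

/-- If the classes `tr = t` are sparse in `B ^ 6`, then `B ^ 2` meets every conjugate of some
torus in many elements: that a torus contains a regular element of `B ^ 4` is inherited by its
conjugates under `B`, hence by all its conjugates. -/
theorem exists_torus {B : Finset SL(2, F)} (hB : Subgroup.closure (B : Set SL(2, F)) = ⊤)
    (h1 : 1 ∈ B) (hinv : B⁻¹ = B) (hcard : 81 < B.card) {m : ℕ} (hm : 7 ≤ m)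
    (hV : ∀ t : F, t ≠ 0 → t ^ 2 ≠ 4 →
      m * ((B ^ 6).filter fun x ↦ x.1.trace = t).card ≤ B.card) :
    ∃ g : SL(2, F), g.1.trace ^ 2 ≠ 4 ∧ ∀ x : SL(2, F),
      m ≤ ((B ^ 2).filter fun y ↦ y * (x * g * x⁻¹) = (x * g * x⁻¹) * y).card := by
  -- a torus containing a regular element of `B ^ 4` meets `B ^ 2` in at least `m` elements
  have step : ∀ h ∈ B ^ 4, h.1.trace ≠ 0 → h.1.trace ^ 2 ≠ 4 →
      m ≤ ((B ^ 2).filter fun y ↦ y * h = h * y).card := by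
    intro h hh hh0 hh4
    have h2 := card_le_card_commute_mul hinv hh
    have h3 := (hV _ hh0 hh4).trans h2
    refine Nat.le_of_mul_le_mul_right h3 ?_
    by_contra! h0
    rw [Nat.le_zero.1 h0, mul_zero] at h2
    omega
  obtain ⟨g, hg, hg0, hg4⟩ := exists_trace_regular hB h1 hinv hcard
  have hgs : ¬ IsScalar g := fun h ↦ hg4 h.trace_sq
  have key : ∀ x : SL(2, F), ∃ h ∈ B ^ 4, h.1.trace ≠ 0 ∧ h.1.trace ^ 2 ≠ 4 ∧
      h * (x * g * x⁻¹) = (x * g * x⁻¹) * h := by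
    intro x
    have hx : x ∈ Subgroup.closure (B : Set SL(2, F)) := by rw [hB]; trivial
    have hmul : ∀ a ∈ B, ∀ x : SL(2, F), (∃ h ∈ B ^ 4, h.1.trace ≠ 0 ∧ h.1.trace ^ 2 ≠ 4 ∧
        h * (x * g * x⁻¹) = (x * g * x⁻¹) * h) → (∃ h ∈ B ^ 4, h.1.trace ≠ 0 ∧
        h.1.trace ^ 2 ≠ 4 ∧ h * (a * x * g * (a * x)⁻¹) = (a * x * g * (a * x)⁻¹) * h) := by
      rintro a ha x ⟨h, hh, hh0, hh4, hc⟩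
      have hle := step h hh hh0 hh4
      -- at most six elements of a torus have trace `0`, `2` or `-2`
      obtain ⟨y, hy, hyh, hy0, hy4⟩ : ∃ y ∈ B ^ 2, y * h = h * y ∧ y.1.trace ≠ 0 ∧
          y.1.trace ^ 2 ≠ 4 := by
        by_contra! hcon
        have hsub : ((B ^ 2).filter fun y ↦ y * h = h * y) ⊆
            ((B ^ 2).filter fun y ↦ y * h = h * y ∧ y.1.trace = 0) ∪
            (((B ^ 2).filter fun y ↦ y * h = h * y ∧ y.1.trace = 2) ∪
            ((B ^ 2).filter fun y ↦ y * h = h * y ∧ y.1.trace = -2)) := by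
          intro y hy
          simp only [Finset.mem_filter, Finset.mem_union] at hy ⊢
          have h3 := hcon y hy.1 hy.2
          by_cases h0 : y.1.trace = 0
          · simp [hy, h0]
          · have h4 := h3 h0
            have h5 : (y.1.trace - 2) * (y.1.trace + 2) = 0 := by linear_combination h4
            rcases mul_eq_zero.1 h5 with h | h
            · simp [hy, sub_eq_zero.1 h]
            · simp [hy, eq_neg_of_add_eq_zero_left h]
        have := (Finset.card_le_card hsub).trans ((Finset.card_union_le _ _).trans
          (add_le_add (card_commute_trace_le hh4 0 (B ^ 2)) ((Finset.card_union_le _ _).trans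
          (add_le_add (card_commute_trace_le hh4 2 (B ^ 2))
            (card_commute_trace_le hh4 (-2) (B ^ 2))))))
        omega
      refine ⟨a * y * a⁻¹, ?_, ?_, ?_, ?_⟩
      · have : B ^ 4 = B * B ^ 2 * B := by rw [← pow_succ', ← pow_succ]
        rw [this]
        refine Finset.mul_mem_mul (Finset.mul_mem_mul ha hy) ?_
        rw [← hinv]
        exact Finset.inv_mem_inv ha
      · rwa [trace_conj]
      · rwa [trace_conj]
      · have hys := commute_of_commute (fun h ↦ hh4 h.trace_sq) hyh hc.symm
        calc a * y * a⁻¹ * (a * x * g * (a * x)⁻¹) = a * (y * (x * g * x⁻¹)) * a⁻¹ := by group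
          _ = a * ((x * g * x⁻¹) * y) * a⁻¹ := by rw [hys]
          _ = _ := by group
    induction hx using Subgroup.closure_induction_left with
    | one => exact ⟨g, hg, hg0, hg4, by simp⟩
    | mul_left a ha x _ ih => exact hmul a ha x ih
    | inv_mul_cancel a ha x _ ih =>
      refine hmul a⁻¹ ?_ x ih
      rw [← hinv]
      exact Finset.inv_mem_inv ha
  refine ⟨g, hg4, fun x ↦ ?_⟩
  obtain ⟨h, hh, hh0, hh4, hc⟩ := key x
  refine (step h hh hh0 hh4).trans (Finset.card_le_card ?_)
  intro y hy
  simp only [Finset.mem_filter] at hy ⊢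
  exact ⟨hy.1, commute_of_commute (fun h ↦ hh4 h.trace_sq) hy.2 hc.symm⟩

/-- A set meeting all conjugates of a torus in `m` elements is large, since these conjugates
intersect in scalars only. -/
theorem card_mul_le_of_torus [Fintype F] {Y : Finset SL(2, F)} {g : SL(2, F)}
    (hg : g.1.trace ^ 2 ≠ 4) {m : ℕ} (hm : ∀ x : SL(2, F),
      m ≤ (Y.filter fun y ↦ y * (x * g * x⁻¹) = (x * g * x⁻¹) * y).card) :
    Fintype.card SL(2, F) * (m - 2) ≤ Y.card * (4 * Fintype.card F) := by
  classical
  rw [← Finset.card_univ]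
  refine Finset.card_mul_le_card_mul (s := Finset.univ) (t := Y)
    (fun x y ↦ ¬ IsScalar y ∧ y * (x * g * x⁻¹) = (x * g * x⁻¹) * y) ?_ ?_
  · intro x _
    have hsc : (Y.filter fun y ↦ IsScalar y).card ≤ 2 := by
      refine (Finset.card_le_card (t := {1, -1}) ?_).trans Finset.card_le_two
      intro y hy
      obtain ⟨-, s1, s2, s3⟩ := Finset.mem_filter.1 hy
      have hd := det_eq y
      rw [s1, ← s3] at hd
      have : (y.1 0 0 - 1) * (y.1 0 0 + 1) = 0 := by linear_combination hd
      simp only [Finset.mem_insert, Finset.mem_singleton]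
      rcases mul_eq_zero.1 this with h | h
      · left
        apply ext_entries
        · simpa using sub_eq_zero.1 h
        · simpa using s1
        · simpa using s2
        · rw [← s3]; simpa using sub_eq_zero.1 h
      · right
        apply ext_entries
        · simpa using eq_neg_of_add_eq_zero_left h
        · simpa using s1
        · simpa using s2
        · rw [← s3]; simpa using eq_neg_of_add_eq_zero_left h
    have hsub : (Y.filter fun y ↦ y * (x * g * x⁻¹) = (x * g * x⁻¹) * y) ⊆
        (Y.filter fun y ↦ ¬ IsScalar y ∧ y * (x * g * x⁻¹) = (x * g * x⁻¹) * y) ∪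
        (Y.filter fun y ↦ IsScalar y) := by
      intro y hy
      simp only [Finset.mem_filter, Finset.mem_union] at hy ⊢
      tauto
    have h1 := (hm x).trans ((Finset.card_le_card hsub).trans (Finset.card_union_le _ _))
    have h2 : m - 2 ≤ (Y.filter fun y ↦ ¬ IsScalar y ∧
        y * (x * g * x⁻¹) = (x * g * x⁻¹) * y).card := by omega
    exact h2
  · intro y _
    change (Finset.univ.filter fun x ↦ _).card ≤ _
    by_cases hys : IsScalar y
    · simp [hys]
    · simp only [hys, not_false_eq_true, true_and]
      have h4 : 4 * Fintype.card F = (2 * Fintype.card F) * 2 := by ring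
      rw [h4]
      refine (Finset.card_le_mul_card_image_of_maps_to (f := fun x ↦ x⁻¹ * y * x)
        (t := Finset.univ.filter fun z ↦ z * g = g * z ∧ z.1.trace = y.1.trace) ?_
        (2 * Fintype.card F) ?_).trans
        (Nat.mul_le_mul_left _ (card_commute_trace_le hg _ _))
      · intro x hx
        simp only [Finset.mem_filter, Finset.mem_univ, true_and] at hx ⊢
        refine ⟨?_, trace_conj' y x⟩
        calc x⁻¹ * y * x * g = x⁻¹ * (y * (x * g * x⁻¹)) * x := by group
          _ = x⁻¹ * ((x * g * x⁻¹) * y) * x := by rw [hx]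
          _ = _ := by group
      · intro z _
        refine le_trans (Finset.card_le_card ?_) (card_conj_eq_le (y := z) hys)
        intro x hx
        simp only [Finset.mem_filter, Finset.mem_univ, true_and] at hx ⊢
        exact hx.2

end
end SLTwo

/-! ### Very large sets -/

namespace SLTwo

section SumProduct

variable {F : Type*} [Field F] [Fintype F] [DecidableEq F]

/-- The solutions of `a + d b = a' + d b'` over all `d ≠ 0`, counted by quadruples. -/
theorem sum_addEnergy_le (Y : Finset F) :
    ∑ d ∈ Finset.univ.erase (0 : F), Finset.addEnergy Y (d • Y) ≤
      Y.card ^ 4 + Fintype.card F * Y.card ^ 2 := by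
  let r : F → (F × F) × F × F → Prop := fun d p ↦ p.1.1 + d * p.2.1 = p.1.2 + d * p.2.2
  let Q := (Y ×ˢ Y) ×ˢ Y ×ˢ Y
  have h1 : ∀ d ∈ Finset.univ.erase (0 : F), Finset.addEnergy Y (d • Y) ≤
      (Q.bipartiteAbove r d).card := by
    intro d hd
    have hd0 : d ≠ 0 := (Finset.mem_erase.1 hd).1
    refine Finset.card_le_card_of_injOn (fun p ↦ (p.1, (d⁻¹ * p.2.1, d⁻¹ * p.2.2))) ?_ ?_
    · rintro ⟨⟨a, a'⟩, b, b'⟩ hp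
      simp only [Finset.coe_filter, Finset.mem_product, Set.mem_ofPred_eq, Finset.mem_coe,
        Finset.mem_bipartiteAbove, Q, r, Finset.mem_smul_finset, smul_eq_mul] at hp ⊢
      obtain ⟨⟨⟨ha, ha'⟩, ⟨b, hb, rfl⟩, ⟨b', hb', rfl⟩⟩, he⟩ := hp
      rw [inv_mul_cancel_left₀ hd0, inv_mul_cancel_left₀ hd0]
      exact ⟨⟨⟨ha, ha'⟩, hb, hb'⟩, he⟩
    · rintro ⟨⟨a, a'⟩, b, b'⟩ _ ⟨⟨c, c'⟩, e, e'⟩ _ h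
      simpa [hd0] using h
  have h2 : ∀ p ∈ Q, ((Finset.univ.erase (0 : F)).bipartiteBelow r p).card ≤
      1 + if p.1.1 = p.1.2 ∧ p.2.1 = p.2.2 then Fintype.card F else 0 := by
    rintro ⟨⟨a, a'⟩, b, b'⟩ _
    by_cases h : a = a' ∧ b = b'
    · rw [if_pos h]
      exact (Finset.card_le_univ _).trans (by omega)
    · rw [if_neg h, add_zero, Finset.card_le_one]
      intro d hd e he
      simp only [Finset.mem_bipartiteBelow, Finset.mem_erase, Finset.mem_univ, and_true, r]
        at hd he
      by_cases hb : b = b'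
      · subst hb
        exact absurd ⟨add_right_cancel hd.2, rfl⟩ h
      · apply mul_right_cancel₀ (sub_ne_zero.2 hb)
        linear_combination hd.2 - he.2
  calc _ ≤ ∑ d ∈ Finset.univ.erase (0 : F), (Q.bipartiteAbove r d).card := Finset.sum_le_sum h1
    _ = ∑ p ∈ Q, ((Finset.univ.erase (0 : F)).bipartiteBelow r p).card :=
      Finset.sum_card_bipartiteAbove_eq_sum_card_bipartiteBelow r
    _ ≤ ∑ p ∈ Q, (1 + if p.1.1 = p.1.2 ∧ p.2.1 = p.2.2 then Fintype.card F else 0) :=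
      Finset.sum_le_sum h2
    _ = Q.card + Fintype.card F * (Q.filter fun p ↦ p.1.1 = p.1.2 ∧ p.2.1 = p.2.2).card := by
      rw [Finset.sum_add_distrib, ← Finset.sum_filter]
      simp [mul_comm]
    _ ≤ _ := by
      have hQ : Q.card = Y.card ^ 4 := by
        simp only [Q, Finset.card_product]; ring
      have hD : (Q.filter fun p ↦ p.1.1 = p.1.2 ∧ p.2.1 = p.2.2).card ≤ Y.card ^ 2 := by
        rw [sq, ← Finset.card_product]
        refine Finset.card_le_card_of_injOn (fun p ↦ (p.1.1, p.2.1)) ?_ ?_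
        · rintro ⟨⟨a, a'⟩, b, b'⟩ hp
          simp only [Finset.coe_filter, Finset.mem_product, Set.mem_ofPred_eq, Finset.mem_coe,
            Q] at hp ⊢
          exact ⟨hp.1.1.1, hp.1.2.1⟩
        · rintro ⟨⟨a, a'⟩, b, b'⟩ hp ⟨⟨c, c'⟩, e, e'⟩ hp' h
          simp only [Finset.coe_filter, Set.mem_ofPred_eq, Prod.mk.injEq] at hp hp' h ⊢
          obtain ⟨-, rfl, rfl⟩ := hp
          obtain ⟨-, rfl, rfl⟩ := hp'
          simp [h]
      rw [hQ]
      gcongr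

/-- By averaging the additive energy of `Y` and `d Y` over `d`, some dilate with `d ∈ D` gives a
sumset covering more than half of the field. -/
theorem exists_large_sumset {D Y : Finset F} (h0 : 0 ∉ D)
    (h : Fintype.card F ^ 2 + Y.card ^ 2 < D.card * Y.card ^ 2) :
    ∃ d ∈ D, Fintype.card F < 2 * (Y + d • Y).card := by
  by_contra! hcon
  set q := Fintype.card F with hq
  have hcs : ∀ d : F, d ≠ 0 → Y.card ^ 4 ≤ (Y + d • Y).card * Finset.addEnergy Y (d • Y) := by
    intro d hd
    have := Finset.le_card_add_mul_addEnergy Y (d • Y)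
    rw [Finset.card_smul_finset₀ hd] at this
    calc Y.card ^ 4 = Y.card ^ 2 * Y.card ^ 2 := by ring
      _ ≤ _ := this
  have hlow : ∀ d ∈ Finset.univ.erase (0 : F), (1 + if d ∈ D then 1 else 0) * Y.card ^ 4 ≤
      q * Finset.addEnergy Y (d • Y) := by
    intro d hd
    have hd0 : d ≠ 0 := (Finset.mem_erase.1 hd).1
    by_cases hdD : d ∈ D
    · rw [if_pos hdD]
      calc (1 + 1) * Y.card ^ 4 ≤ 2 * ((Y + d • Y).card * Finset.addEnergy Y (d • Y)) := by
            have := hcs d hd0; omega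
        _ = 2 * (Y + d • Y).card * Finset.addEnergy Y (d • Y) := by ring
        _ ≤ _ := Nat.mul_le_mul_right _ (hcon d hdD)
    · rw [if_neg hdD, add_zero, one_mul]
      exact (hcs d hd0).trans (Nat.mul_le_mul_right _ (Finset.card_le_univ _))
  have hsum := Finset.sum_le_sum hlow
  rw [← Finset.mul_sum, ← Finset.sum_mul, Finset.sum_add_distrib, ← Finset.card_eq_sum_ones,
    ← Finset.sum_filter, ← Finset.card_eq_sum_ones, Finset.card_erase_of_mem (Finset.mem_univ _),
    Finset.card_univ, ← hq] at hsum
  have hDf : (Finset.univ.erase (0 : F)).filter (fun d ↦ d ∈ D) = D := by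
    ext d
    simp only [Finset.mem_filter, Finset.mem_erase, Finset.mem_univ, and_true]
    exact ⟨fun h ↦ h.2, fun h ↦ ⟨fun h' ↦ h0 (h' ▸ h), h⟩⟩
  rw [hDf] at hsum
  have hup := Nat.mul_le_mul_left q (sum_addEnergy_le Y)
  rw [← hq] at hup
  have hall := hsum.trans hup
  have hq1 : 1 ≤ q := Fintype.card_pos
  have hY : 0 < Y.card ^ 2 := by
    by_contra! hY
    rw [Nat.le_zero.1 hY] at h
    omega
  obtain ⟨p, hp⟩ := Nat.exists_eq_add_of_le hq1
  have hp1 : q - 1 = p := by omega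
  rw [hp1] at hall
  have e1 : D.card * Y.card ^ 2 * Y.card ^ 2 ≤ (q ^ 2 + Y.card ^ 2) * Y.card ^ 2 := by
    rw [hp] at hall ⊢
    nlinarith
  exact absurd (Nat.le_of_mul_le_mul_right e1 hY) (by omega)

/-- Two sets covering more than half of a finite additive group add up to everything. -/
theorem exists_add_eq {W : Finset F} (h : Fintype.card F < 2 * W.card) (z : F) :
    ∃ a ∈ W, ∃ b ∈ W, a + b = z := by
  have h1 : (W.image fun w ↦ z - w).card = W.card :=
    Finset.card_image_of_injective _ (fun a b h ↦ by simpa using h)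
  obtain ⟨a, ha⟩ := Finset.inter_nonempty_of_card_lt_card_add_card (s := Finset.univ)
    (Finset.subset_univ W) (Finset.subset_univ (W.image fun w ↦ z - w))
    (by rw [h1, Finset.card_univ]; omega)
  obtain ⟨ha, hb⟩ := Finset.mem_inter.1 ha
  obtain ⟨b, hbW, rfl⟩ := Finset.mem_image.1 hb
  exact ⟨z - b, ha, b, hbW, by ring⟩

end SumProduct

variable {F : Type*} [Field F]

/-- The upper unitriangular matrix with entry `u`. -/
def upper (u : F) : SL(2, F) := ⟨!![1, u; 0, 1], by simp [Matrix.det_fin_two_of]⟩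

/-- The lower unitriangular matrix with entry `u`. -/
def lower (u : F) : SL(2, F) := ⟨!![1, 0; u, 1], by simp [Matrix.det_fin_two_of]⟩

section entries
variable (u : F)
@[simp] theorem upper_00 : (upper u).1 0 0 = 1 := rfl
@[simp] theorem upper_01 : (upper u).1 0 1 = u := rfl
@[simp] theorem upper_10 : (upper u).1 1 0 = 0 := rfl
@[simp] theorem upper_11 : (upper u).1 1 1 = 1 := rfl
@[simp] theorem lower_00 : (lower u).1 0 0 = 1 := rfl
@[simp] theorem lower_01 : (lower u).1 0 1 = 0 := rfl
@[simp] theorem lower_10 : (lower u).1 1 0 = u := rfl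
@[simp] theorem lower_11 : (lower u).1 1 1 = 1 := rfl
end entries

theorem upper_add (u v : F) : upper (u + v) = upper u * upper v := by
  apply ext_entries <;> simp [add_comm]

/-- The big cell: an element with nonzero lower left entry lies in `U U⁻ U`. -/
theorem eq_upper_lower_upper {g : SL(2, F)} (h : g.1 1 0 ≠ 0) :
    g = upper ((g.1 0 0 - 1) / g.1 1 0) * lower (g.1 1 0) *
      upper ((g.1 1 1 - 1) / g.1 1 0) := by
  have hd := det_eq g
  apply ext_entries <;> simp <;> field_simp <;>
    first | ring1 | linear_combination -hd

/-- `SL₂(F) = U U⁻ U U⁻`. -/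
theorem exists_upper_lower (g : SL(2, F)) :
    ∃ a b c d : F, g = upper a * lower b * upper c * lower d := by
  by_cases h : g.1 1 0 = 0
  · have hd := det_eq g
    have h11 : g.1 1 1 ≠ 0 := by
      intro h11
      rw [h, h11] at hd
      simp at hd
    have h' : (g * lower 1).1 1 0 ≠ 0 := by simpa [h] using h11
    obtain ⟨a, b, c, e⟩ : ∃ a b c, g * lower 1 = upper a * lower b * upper c :=
      ⟨_, _, _, eq_upper_lower_upper h'⟩
    refine ⟨a, b, c, -1, ?_⟩
    rw [← e, mul_assoc]
    have : lower 1 * lower (-1 : F) = 1 := by apply ext_entries <;> simp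
    rw [this, mul_one]
  · obtain ⟨a, b, c, e⟩ : ∃ a b c, g = upper a * lower b * upper c :=
      ⟨_, _, _, eq_upper_lower_upper h⟩
    refine ⟨a, b, c, 0, ?_⟩
    have : lower (0 : F) = 1 := by apply ext_entries <;> simp
    rw [this, mul_one, ← e]

/-- The Weyl element exchanging the two unipotent subgroups. -/
def weyl (F : Type*) [Field F] : SL(2, F) := ⟨!![0, 1; -1, 0], by simp [Matrix.det_fin_two_of]⟩

theorem lower_eq_conj (u : F) : lower u = (weyl F)⁻¹ * upper (-u) * weyl F := by
  have h00 : (weyl F).1 0 0 = 0 := rfl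
  have h01 : (weyl F).1 0 1 = 1 := rfl
  have h10 : (weyl F).1 1 0 = -1 := rfl
  have h11 : (weyl F).1 1 1 = 0 := rfl
  apply ext_entries <;> simp [h00, h01, h10, h11]

section Finite
variable [Fintype F] [DecidableEq F]

/-- A very large symmetric set contains all upper unitriangular matrices in its sixteenth power:
its square contains many `upper y` and many upper triangular `p`, and conjugation by `p`
multiplies `y` by the square of the first diagonal entry of `p`. -/
theorem upper_mem_pow {B : Finset SL(2, F)} (hinv : B⁻¹ = B)
    (hn : 8 * Fintype.card F ^ 8 < B.card ^ 3) (z : F) : upper z ∈ B ^ 16 := by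
  classical
  set q := Fintype.card F with hq
  have hq1 : 1 ≤ q := Fintype.card_pos
  have hinv_mem : ∀ b ∈ B, b⁻¹ ∈ B := fun b hb ↦ by
    rw [← hinv]; exact Finset.inv_mem_inv hb
  let Y : Finset F := Finset.univ.filter fun u ↦ upper u ∈ B ^ 2
  let P : Finset SL(2, F) := (B ^ 2).filter fun b ↦ b.1 1 0 = 0
  let D₁ : Finset F := P.image fun b ↦ b.1 0 0
  let D : Finset F := D₁.image fun a ↦ a ^ 2
  -- pigeonhole on the cosets of the unipotent subgroup
  have hY : B.card ≤ Y.card * q ^ 2 := by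
    have huniv : (Finset.univ : Finset (F × F)).card = q ^ 2 := by
      rw [Finset.card_univ, Fintype.card_prod, sq]
    rw [← huniv]
    refine Finset.card_le_mul_card_image_of_maps_to (f := fun b ↦ (b.1 0 0, b.1 1 0))
      (by simp) _ ?_
    rintro ⟨s, t⟩ -
    rcases (B.filter fun b ↦ (b.1 0 0, b.1 1 0) = (s, t)).eq_empty_or_nonempty with h | ⟨b, hb⟩
    · rw [h]; simp
    · have key : ∀ c, (c.1 0 0, c.1 1 0) = (s, t) → upper ((b⁻¹ * c).1 0 1) = b⁻¹ * c := by
        intro c hc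
        have hb' := (Finset.mem_filter.1 hb).2
        simp only [Prod.mk.injEq] at hc hb'
        have hd := det_eq b
        have hd' := det_eq c
        rw [hb'.1, hb'.2] at hd
        rw [hc.1, hc.2] at hd'
        apply ext_entries <;> simp [hc.1, hc.2, hb'.1, hb'.2]
        · linear_combination -hd
        · ring
        · linear_combination -hd'
      refine Finset.card_le_card_of_injOn (fun c ↦ (b⁻¹ * c).1 0 1) ?_ ?_
      · intro c hc
        simp only [Finset.coe_filter, Set.mem_ofPred_eq, Y, Finset.mem_univ, true_and] at hc hb ⊢
        rw [key c hc.2, sq]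
        exact Finset.mul_mem_mul (hinv_mem b (Finset.mem_filter.1 hb).1) hc.1
      · intro c hc c' hc' h
        simp only [Finset.coe_filter, Set.mem_ofPred_eq] at hc hc' h
        have := key c hc.2
        rw [h, key c' hc'.2] at this
        exact (mul_left_cancel this).symm
  -- pigeonhole on the cosets of the Borel subgroup, indexed by the projective line
  have hP : B.card ≤ P.card * (q + 1) := by
    have huniv : (Finset.univ : Finset (Option F)).card = q + 1 := by
      rw [Finset.card_univ, Fintype.card_option]
    rw [← huniv]
    refine Finset.card_le_mul_card_image_of_maps_to
      (f := fun b : SL(2, F) ↦ if b.1 0 0 = 0 then none else some (b.1 1 0 / b.1 0 0)) (by simp) _ ?_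
    intro s _
    rcases (B.filter fun b : SL(2, F) ↦ (if b.1 0 0 = 0 then none else
      some (b.1 1 0 / b.1 0 0)) = s).eq_empty_or_nonempty with h | ⟨b, hb⟩
    · rw [h]; simp
    · refine Finset.card_le_card_of_injOn (fun c ↦ b⁻¹ * c) ?_ (by intro c _ c' _; simp)
      intro c hc
      simp only [Finset.coe_filter, Set.mem_ofPred_eq, P, Finset.mem_filter] at hc hb ⊢
      constructor
      · rw [sq]
        exact Finset.mul_mem_mul (hinv_mem b hb.1) hc.1
      · have h := hc.2.trans hb.2.symm
        rw [mul_10, inv_10, inv_11]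
        by_cases h1 : c.1 0 0 = 0
        · rw [if_pos h1] at h
          by_cases h2 : b.1 0 0 = 0
          · rw [h1, h2]; ring
          · rw [if_neg h2] at h
            simp at h
        · rw [if_neg h1] at h
          by_cases h2 : b.1 0 0 = 0
          · rw [if_pos h2] at h
            simp at h
          · rw [if_neg h2, Option.some.injEq, div_eq_div_iff h1 h2] at h
            linear_combination h
  have hPD : P.card ≤ q * D₁.card := by
    refine Finset.card_le_mul_card_image (f := fun b ↦ b.1 0 0) P q ?_
    intro a _
    refine Finset.card_le_card_of_injOn (t := Finset.univ) (fun c ↦ c.1 0 1) (by simp) ?_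
    intro c hc c' hc' h
    simp only [Finset.coe_filter, Set.mem_ofPred_eq, P, Finset.mem_filter] at hc hc' h
    have hd := det_eq c
    have hd' := det_eq c'
    rw [hc.1.2, hc.2] at hd
    rw [hc'.1.2, hc'.2] at hd'
    have ha : a ≠ 0 := by
      rintro rfl
      simp at hd
    apply ext_entries
    · rw [hc.2, hc'.2]
    · exact h
    · rw [hc.1.2, hc'.1.2]
    · apply mul_left_cancel₀ ha
      linear_combination hd - hd'
  have hD : D₁.card ≤ 2 * D.card := by
    refine Finset.card_le_mul_card_image (f := fun a ↦ a ^ 2) D₁ 2 ?_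
    intro a ha
    obtain ⟨b, hb, rfl⟩ := Finset.mem_image.1 ha
    refine (Finset.card_le_card (t := {b, -b}) ?_).trans Finset.card_le_two
    intro c hc
    simpa [sq_eq_sq_iff_eq_or_eq_neg] using (Finset.mem_filter.1 hc).2
  have h0 : (0 : F) ∉ D := by
    intro h
    obtain ⟨a, ha, ha0⟩ := Finset.mem_image.1 h
    obtain ⟨b, hb, rfl⟩ := Finset.mem_image.1 ha
    have hb0 := (Finset.mem_filter.1 hb).2
    have hd := det_eq b
    rw [hb0, pow_eq_zero_iff two_ne_zero |>.1 ha0] at hd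
    simp at hd
  have hnD : B.card ≤ 4 * q ^ 2 * D.card := by
    calc B.card ≤ P.card * (q + 1) := hP
      _ ≤ (q * (2 * D.card)) * (2 * q) := by
        refine Nat.mul_le_mul (hPD.trans (Nat.mul_le_mul_left _ hD)) (by omega)
      _ = _ := by ring
  have hDY : 2 * q ^ 2 < D.card * Y.card ^ 2 := by
    have h3 : B.card ^ 3 ≤ (D.card * Y.card ^ 2) * (4 * q ^ 6) := by
      calc B.card ^ 3 = B.card * B.card ^ 2 := by ring
        _ ≤ (4 * q ^ 2 * D.card) * (Y.card * q ^ 2) ^ 2 :=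
          Nat.mul_le_mul hnD (Nat.pow_le_pow_left hY 2)
        _ = _ := by ring
    have h4 : (2 * q ^ 2) * (4 * q ^ 6) < (D.card * Y.card ^ 2) * (4 * q ^ 6) := by
      calc (2 * q ^ 2) * (4 * q ^ 6) = 8 * q ^ 8 := by ring
        _ < _ := hn.trans_le h3
    exact Nat.lt_of_mul_lt_mul_right h4
  have hYq : Y.card ≤ q := Finset.card_le_univ _
  have hDlt : q ^ 2 + Y.card ^ 2 < D.card * Y.card ^ 2 := by
    have : Y.card ^ 2 ≤ q ^ 2 := Nat.pow_le_pow_left hYq 2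
    omega
  obtain ⟨d, hd, hlarge⟩ := exists_large_sumset h0 hDlt
  obtain ⟨a, ha, b, hb, rfl⟩ := exists_add_eq hlarge z
  have hW : ∀ a ∈ Y + d • Y, upper a ∈ B ^ 8 := by
    intro a ha
    obtain ⟨y, hy, w, hw, rfl⟩ := Finset.mem_add.1 ha
    obtain ⟨y', hy', rfl⟩ := Finset.mem_smul_finset.1 hw
    obtain ⟨e, he, rfl⟩ := Finset.mem_image.1 hd
    obtain ⟨p, hp, rfl⟩ := Finset.mem_image.1 he
    obtain ⟨hpB, hp0⟩ := Finset.mem_filter.1 hp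
    have hy := (Finset.mem_filter.1 hy).2
    have hy' := (Finset.mem_filter.1 hy').2
    have hpinv : p⁻¹ ∈ B ^ 2 := by
      rw [← hinv, inv_pow]
      exact Finset.inv_mem_inv hpB
    have hconj : upper (p.1 0 0 ^ 2 • y') = p * upper y' * p⁻¹ := by
      have hdp := det_eq p
      rw [hp0] at hdp
      apply ext_entries <;> simp [hp0]
      · linear_combination -hdp
      · ring
      · linear_combination -hdp
    rw [upper_add, hconj]
    have : B ^ 8 = B ^ 2 * (B ^ 2 * B ^ 2 * B ^ 2) := by simp only [← pow_add]
    rw [this]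
    exact Finset.mul_mem_mul hy (Finset.mul_mem_mul (Finset.mul_mem_mul hpB hy') hpinv)
  rw [upper_add]
  have : B ^ 16 = B ^ 8 * B ^ 8 := by rw [← pow_add]
  rw [this]
  exact Finset.mul_mem_mul (hW a ha) (hW b hb)

/-- A symmetric set of more than `2 q ^ (8 / 3)` elements generates the group in 64 steps. -/
theorem pow_eq_univ_of_card {B : Finset SL(2, F)} (hinv : B⁻¹ = B)
    (hn : 8 * Fintype.card F ^ 8 < B.card ^ 3) : B ^ 64 = Finset.univ := by
  classical
  have hU := upper_mem_pow hinv hn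
  have hL : ∀ z, lower z ∈ B ^ 16 := by
    intro z
    let φ : SL(2, F) ≃* SL(2, F) := MulAut.conj (weyl F)
    have hφ : (B.image φ)⁻¹ = B.image φ := by
      rw [← Finset.image_inv, hinv]
    have h := upper_mem_pow (B := B.image φ) hφ
      (by rwa [Finset.card_image_of_injective _ φ.injective]) (-z)
    rw [← Finset.image_pow] at h
    obtain ⟨b, hb, hbz⟩ := Finset.mem_image.1 h
    rw [lower_eq_conj, ← hbz]
    simpa [φ, mul_assoc] using hb
  have h64 : B ^ 64 = B ^ 16 * B ^ 16 * B ^ 16 * B ^ 16 := by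
    rw [← pow_add, ← pow_add, ← pow_add]
  rw [h64, Finset.eq_univ_iff_forall]
  intro g
  obtain ⟨a, b, c, d, rfl⟩ := exists_upper_lower g
  exact Finset.mul_mem_mul (Finset.mul_mem_mul (Finset.mul_mem_mul (hU a) (hL b)) (hU c)) (hL d)

end Finite
end SLTwo

/-! ### Tripling and growth -/

section Group
variable {G : Type*} [Group G] [DecidableEq G]

theorem Finset.symm_inv (A : Finset G) : (A ∪ A⁻¹ ∪ {1})⁻¹ = A ∪ A⁻¹ ∪ {1} := by
  ext x
  simp only [Finset.mem_inv', Finset.mem_union, Finset.mem_singleton, inv_inv, inv_eq_one]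
  tauto

/-- Small tripling passes to the symmetrization `A ∪ A⁻¹ ∪ {1}`. -/
theorem Finset.card_symm_pow_three_le {A : Finset G} (hne : A.Nonempty) {K : ℝ}
    (hA : ((A ^ 3).card : ℝ) ≤ K * A.card) :
    (((A ∪ A⁻¹ ∪ {1}) ^ 3).card : ℝ) ≤ 27 * K ^ 3 * A.card := by
  have tri : ∀ e : Fin 3 → ℤ, (∀ i, |e i| = 1) →
      ((A ^ e 0 * A ^ e 1 * A ^ e 2).card : ℝ) ≤ K ^ 3 * A.card := by
    intro e he
    have := Finset.small_alternating_pow_of_small_tripling (m := 3) le_rfl hA e he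
    simpa [List.finRange_succ, mul_assoc] using this
  have one : ∀ e₁ e₂ e₃ : ℤ, |e₁| = 1 → |e₂| = 1 → |e₃| = 1 →
      ((A ^ e₁ * A ^ e₂ * A ^ e₃).card : ℝ) ≤ K ^ 3 * A.card := by
    intro e₁ e₂ e₃ h₁ h₂ h₃
    refine tri ![e₁, e₂, e₃] fun i ↦ ?_
    fin_cases i <;> simpa
  have t3 : ∀ X ∈ ({A, A⁻¹} : Set (Finset G)), ∀ Y ∈ ({A, A⁻¹} : Set (Finset G)),
      ∀ Z ∈ ({A, A⁻¹} : Set (Finset G)), ((X * Y * Z).card : ℝ) ≤ K ^ 3 * A.card := by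
    have hex : ∀ X ∈ ({A, A⁻¹} : Set (Finset G)), ∃ e : ℤ, |e| = 1 ∧ X = A ^ e := by
      rintro X (rfl | rfl)
      · exact ⟨1, by simp, by simp⟩
      · exact ⟨-1, by simp, by simp⟩
    intro X hX Y hY Z hZ
    obtain ⟨e₁, h₁, rfl⟩ := hex X hX
    obtain ⟨e₂, h₂, rfl⟩ := hex Y hY
    obtain ⟨e₃, h₃, rfl⟩ := hex Z hZ
    exact one _ _ _ h₁ h₂ h₃
  have hAA : A ∈ ({A, A⁻¹} : Set (Finset G)) := by simp
  have t2 : ∀ X ∈ ({A, A⁻¹} : Set (Finset G)), ∀ Y ∈ ({A, A⁻¹} : Set (Finset G)),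
      ((X * Y).card : ℝ) ≤ K ^ 3 * A.card := by
    intro X hX Y hY
    refine le_trans ?_ (t3 X hX Y hY A hAA)
    exact_mod_cast Finset.card_le_card_mul_right hne
  have t1 : ∀ X ∈ ({A, A⁻¹} : Set (Finset G)), (X.card : ℝ) ≤ K ^ 3 * A.card := by
    intro X hX
    refine le_trans ?_ (t2 X hX A hAA)
    exact_mod_cast Finset.card_le_card_mul_right hne
  have t0 : (1 : ℝ) ≤ K ^ 3 * A.card := by
    refine le_trans ?_ (t1 A hAA)
    exact_mod_cast hne.card_pos
  have tall : ∀ X ∈ ({A, A⁻¹, 1} : Finset (Finset G)), ∀ Y ∈ ({A, A⁻¹, 1} : Finset (Finset G)),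
      ∀ Z ∈ ({A, A⁻¹, 1} : Finset (Finset G)), ((X * Y * Z).card : ℝ) ≤ K ^ 3 * A.card := by
    have hor : ∀ X ∈ ({A, A⁻¹, 1} : Finset (Finset G)),
        X ∈ ({A, A⁻¹} : Set (Finset G)) ∨ X = 1 := by
      intro X hX
      simp only [Finset.mem_insert, Finset.mem_singleton] at hX
      simp only [Set.mem_insert_iff, Set.mem_singleton_iff]
      tauto
    intro X hX Y hY Z hZ
    rcases hor X hX with hX | rfl <;> rcases hor Y hY with hY | rfl <;>
      rcases hor Z hZ with hZ | rfl <;> try simp only [one_mul, mul_one]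
    · exact t3 X hX Y hY Z hZ
    · exact t2 X hX Y hY
    · exact t2 X hX Z hZ
    · exact t1 X hX
    · exact t2 Y hY Z hZ
    · exact t1 Y hY
    · exact t1 Z hZ
    · simpa using t0
  let T : Finset (Finset G) := {A, A⁻¹, 1}
  have hT : T.card ≤ 3 := Finset.card_le_three
  have hsub : (A ∪ A⁻¹ ∪ {1}) ^ 3 ⊆
      (T ×ˢ T ×ˢ T).biUnion fun p ↦ p.1 * p.2.1 * p.2.2 := by
    have hex : ∀ x ∈ A ∪ A⁻¹ ∪ {1}, ∃ X ∈ T, x ∈ X := by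
      intro x hx
      simp only [Finset.mem_union, Finset.mem_singleton] at hx
      rcases hx with (hx | hx) | rfl
      · exact ⟨A, by simp [T], hx⟩
      · exact ⟨A⁻¹, by simp [T], hx⟩
      · exact ⟨1, by simp [T], by simp⟩
    intro w hw
    rw [pow_succ, sq] at hw
    obtain ⟨xy, hxy, z, hz, rfl⟩ := Finset.mem_mul.1 hw
    obtain ⟨x, hx, y, hy, rfl⟩ := Finset.mem_mul.1 hxy
    obtain ⟨X, hX, hx⟩ := hex x hx
    obtain ⟨Y, hY, hy⟩ := hex y hy
    obtain ⟨Z, hZ, hz⟩ := hex z hz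
    refine Finset.mem_biUnion.2 ⟨(X, Y, Z), by simp [hX, hY, hZ], ?_⟩
    exact Finset.mul_mem_mul (Finset.mul_mem_mul hx hy) hz
  calc (((A ∪ A⁻¹ ∪ {1}) ^ 3).card : ℝ)
      ≤ (∑ p ∈ T ×ˢ T ×ˢ T, (p.1 * p.2.1 * p.2.2).card : ℕ) := by
        exact_mod_cast (Finset.card_le_card hsub).trans Finset.card_biUnion_le
    _ ≤ ∑ p ∈ T ×ˢ T ×ˢ T, K ^ 3 * A.card := by
        push_cast
        refine Finset.sum_le_sum fun p hp ↦ ?_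
        simp only [Finset.mem_product] at hp
        exact tall _ hp.1 _ hp.2.1 _ hp.2.2
    _ = (T.card ^ 3 : ℕ) * (K ^ 3 * A.card) := by
        rw [Finset.sum_const, nsmul_eq_mul]
        simp only [Finset.card_product]
        congr 2
        ring
    _ ≤ (3 ^ 3 : ℕ) * (K ^ 3 * A.card) := by
        have := Nat.pow_le_pow_left hT 3
        have h0 : (0 : ℝ) ≤ K ^ 3 * A.card := zero_le_one.trans t0
        gcongr
    _ = _ := by push_cast; ring

/-- The powers of a generating set containing `1` exhaust a finite group. -/
theorem Finset.pow_eq_univ_of_card_le [Fintype G] {B : Finset G}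
    (hB : Subgroup.closure (B : Set G) = ⊤) (h1 : 1 ∈ B) (hinv : B⁻¹ = B) {k : ℕ}
    (hk : Fintype.card G ≤ k) : B ^ k = Finset.univ := by
  classical
  have h := Group.card_pow_eq_card_pow_card_univ (B : Set G) k hk
  have h' := Group.card_pow_eq_card_pow_card_univ (B : Set G) (k + 1) (by omega)
  have heq : B ^ k = B ^ (k + 1) := by
    refine Finset.eq_of_subset_of_card_le (Finset.pow_subset_pow_right h1 (Nat.le_succ k)) ?_
    have := h'.trans h.symm
    rw [← Nat.card_eq_fintype_card, ← Nat.card_eq_fintype_card, Nat.card_coe_set_eq,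
      Nat.card_coe_set_eq, ← Finset.coe_pow, ← Finset.coe_pow, Set.ncard_coe_finset,
      Set.ncard_coe_finset] at this
    exact this.le
  have hstep : ∀ b ∈ B, ∀ x ∈ B ^ k, b * x ∈ B ^ k := by
    intro b hb x hx
    rw [heq, pow_succ']
    exact Finset.mul_mem_mul hb hx
  rw [Finset.eq_univ_iff_forall]
  intro g
  have hg : g ∈ Subgroup.closure (B : Set G) := by rw [hB]; trivial
  induction hg using Subgroup.closure_induction_left with
  | one => exact Finset.one_mem_pow h1
  | mul_left a ha x _ ih => exact hstep a ha x ih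
  | inv_mul_cancel a ha x _ ih =>
    refine hstep a⁻¹ ?_ x ih
    rw [← hinv]
    exact Finset.inv_mem_inv ha

/-- A generating set that does not grow at all under tripling is a union of conjugacy classes. -/
theorem Finset.conj_mem_of_card_pow_three_le {A : Finset G}
    (hA : Subgroup.closure (A : Set G) = ⊤) (hne : A.Nonempty) (h : (A ^ 3).card ≤ A.card)
    (g : G) : ∀ y ∈ A, g⁻¹ * y * g ∈ A ∧ g * y * g⁻¹ ∈ A := by
  have h2 : (A * A).card ≤ A.card := by
    rw [← sq]
    exact (hne.card_pow_mono (by norm_num) : (A ^ 2).card ≤ (A ^ 3).card).trans h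
  have hg : g ∈ Subgroup.closure (A : Set G) := by rw [hA]; trivial
  induction hg using Subgroup.closure_induction with
  | mem x hx =>
    have hl : A.image (fun y ↦ x * y) = A * A := by
      refine Finset.eq_of_subset_of_card_le ?_ ?_
      · intro z hz
        obtain ⟨y, hy, rfl⟩ := Finset.mem_image.1 hz
        exact Finset.mul_mem_mul hx hy
      · rwa [Finset.card_image_of_injective _ (mul_right_injective x)]
    have hr : A.image (fun y ↦ y * x) = A * A := by
      refine Finset.eq_of_subset_of_card_le ?_ ?_
      · intro z hz
        obtain ⟨y, hy, rfl⟩ := Finset.mem_image.1 hz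
        exact Finset.mul_mem_mul hy hx
      · rwa [Finset.card_image_of_injective _ (mul_left_injective x)]
    intro y hy
    constructor
    · have := Finset.mul_mem_mul hy hx
      rw [← hl] at this
      obtain ⟨z, hz, hzy⟩ := Finset.mem_image.1 this
      rw [mul_assoc, ← hzy, inv_mul_cancel_left]
      exact hz
    · have := Finset.mul_mem_mul hx hy
      rw [← hr] at this
      obtain ⟨z, hz, hzy⟩ := Finset.mem_image.1 this
      rw [← hzy, mul_inv_cancel_right]
      exact hz
  | one => simp
  | mul a b _ _ ha hb =>
    intro y hy
    constructor
    · simpa [mul_assoc] using (hb _ (ha y hy).1).1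
    · simpa [mul_assoc] using (ha _ (hb y hy).2).2
  | inv a _ ha =>
    intro y hy
    simpa using (ha y hy).symm

end Group

namespace SLTwo

variable {F : Type*} [Field F]

theorem exists_not_isScalar {A : Set SL(2, F)} (hA : Subgroup.closure A = ⊤) :
    ∃ x ∈ A, ¬ IsScalar x := by
  by_contra! h
  have hle : Subgroup.closure A ≤ Subgroup.center SL(2, F) := by
    rw [Subgroup.closure_le]
    intro x hx
    exact Subgroup.mem_center_iff.2 fun g ↦ ((h x hx).commute g).symm
  have hu : upper (1 : F) ∈ Subgroup.center SL(2, F) := hle (by rw [hA]; trivial)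
  have hc := Subgroup.mem_center_iff.1 hu (lower 1)
  have := congrArg (fun g : SL(2, F) ↦ g.1 0 0) hc
  simp at this

variable [Fintype F] [DecidableEq F]

theorem sq_card_le_of_card_pow_three_le {A : Finset SL(2, F)}
    (hA : Subgroup.closure (A : Set SL(2, F)) = ⊤) (h : (A ^ 3).card ≤ A.card) :
    Fintype.card F ^ 2 ≤ 4 * A.card := by
  obtain ⟨x, hx, hxs⟩ := exists_not_isScalar hA
  have h1 : Fintype.card SL(2, F) ≤ 2 * Fintype.card F * A.card := by
    rw [← Finset.card_univ]
    refine Finset.card_le_mul_card_image_of_maps_to (f := fun g ↦ g⁻¹ * x * g) ?_ _ ?_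
    · intro g _
      exact (Finset.conj_mem_of_card_pow_three_le hA ⟨x, hx⟩ h g x hx).1
    · intro y _
      exact card_conj_eq_le hxs
  have h2 := pow_three_le_card (F := F)
  have hq : 0 < Fintype.card F := Fintype.card_pos
  refine Nat.le_of_mul_le_mul_left ?_ hq
  calc Fintype.card F * Fintype.card F ^ 2 = Fintype.card F ^ 3 := by ring
    _ ≤ 2 * (2 * Fintype.card F * A.card) := h2.trans (Nat.mul_le_mul_left 2 h1)
    _ = _ := by ring

/-- A symmetric generating set `B` of small tripling that is not tiny has `|B| ≫ q ^ 3`, up to a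
power of the tripling constant: the classes `tr = t` meet `B ^ 6` in `≪ |B| ^ (2 / 3)` elements,
so all conjugates of some torus meet `B ^ 2` in `≫ |B| ^ (1 / 3)` elements, and there are
about `q ^ 2` conjugates. -/
theorem card_pow_six_le {B : Finset SL(2, F)} (hB : Subgroup.closure (B : Set SL(2, F)) = ⊤)
    (h1 : 1 ∈ B) (hinv : B⁻¹ = B) {L : ℝ} (hL : 1 ≤ L) (h3 : ((B ^ 3).card : ℝ) ≤ L * B.card)
    (hn : 343 * (4096 * L ^ 32) ≤ B.card) :
    (Fintype.card F : ℝ) ^ 6 ≤ 2 ^ 24 * L ^ 35 * (B.card : ℝ) ^ 2 := by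
  set q := Fintype.card F with hq
  obtain ⟨n, hnB⟩ : ∃ n : ℝ, n = B.card := ⟨_, rfl⟩
  rw [← hnB] at hn h3 ⊢
  have hL32 : (1 : ℝ) ≤ L ^ 32 := one_le_pow₀ hL
  have hn81 : 81 < B.card := by
    have : (81 : ℝ) < B.card := by rw [← hnB]; linarith
    exact_mod_cast this
  have hn0 : 0 < n := by linarith
  set c : ℝ := 4096 * L ^ 32 with hc
  have hc0 : 0 < c := by positivity
  obtain ⟨x, hx0, hx⟩ : ∃ x : ℝ, 0 ≤ x ∧ x ^ 3 = n / c := by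
    refine ⟨(n / c) ^ ((3 : ℕ) : ℝ)⁻¹, by positivity, ?_⟩
    exact Real.rpow_inv_natCast_pow (by positivity) (by norm_num)
  have hx7 : 7 ≤ x := by
    have : (7 : ℝ) ^ 3 ≤ x ^ 3 := by
      rw [hx, le_div_iff₀ hc0]
      linarith
    exact le_of_pow_le_pow_left₀ (by norm_num) hx0 this
  obtain ⟨m, hm⟩ : ∃ m, m = ⌊x⌋₊ := ⟨_, rfl⟩
  have hm7 : 7 ≤ m := by
    rw [hm]
    exact Nat.le_floor (by exact_mod_cast hx7)
  have hmx : (m : ℝ) ≤ x := by rw [hm]; exact Nat.floor_le hx0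
  have hmx' : x < m + 1 := by rw [hm]; exact Nat.lt_floor_add_one x
  have hBne : B.Nonempty := ⟨1, h1⟩
  have hB6 : Subgroup.closure ((B ^ 6 : Finset SL(2, F)) : Set SL(2, F)) = ⊤ := by
    rw [eq_top_iff, ← hB]
    exact Subgroup.closure_mono (by
      have := Finset.pow_subset_pow_right h1 (show 1 ≤ 6 by norm_num)
      rw [pow_one] at this
      exact_mod_cast this)
  have h18 : ((B ^ 18).card : ℝ) ≤ L ^ 16 * n := by
    rw [hnB] at h3 ⊢
    exact Finset.small_pow_of_small_tripling (by norm_num) h3 hinv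
  obtain ⟨g, hg, hgm⟩ := exists_torus hB h1 hinv hn81 hm7 (by
    intro t ht ht4
    have hv := card_trace_pow_three_le hB6 hBne.pow ht ht4
    rw [← pow_mul] at hv
    set v := ((B ^ 6).filter fun x ↦ x.1.trace = t).card
    have hv' : (v : ℝ) ^ 3 ≤ c * n ^ 2 := by
      calc (v : ℝ) ^ 3 ≤ 4096 * ((B ^ 18).card : ℝ) ^ 2 := by exact_mod_cast hv
        _ ≤ 4096 * (L ^ 16 * n) ^ 2 := by gcongr
        _ = _ := by rw [hc]; ring
    have : ((m * v : ℕ) : ℝ) ^ 3 ≤ n ^ 3 := by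
      push_cast
      calc ((m : ℝ) * v) ^ 3 = (m : ℝ) ^ 3 * (v : ℝ) ^ 3 := by ring
        _ ≤ x ^ 3 * (c * n ^ 2) := by gcongr
        _ = n ^ 3 := by rw [hx]; field_simp
    have := le_of_pow_le_pow_left₀ (by norm_num) hn0.le this
    rw [hnB] at this
    exact_mod_cast this)
  have hfin := card_mul_le_of_torus hg hgm
  rw [← hq] at hfin
  have hG := pow_three_le_card (F := F)
  rw [← hq] at hG
  have hB2 : ((B ^ 2).card : ℝ) ≤ L * n := by
    refine le_trans ?_ h3
    exact_mod_cast (hBne.card_pow_mono (by norm_num) : (B ^ 2).card ≤ (B ^ 3).card)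
  have hq0 : (0 : ℝ) < q := by exact_mod_cast Fintype.card_pos (α := F)
  have hfin' : (Fintype.card SL(2, F) : ℝ) * ((m : ℝ) - 2) ≤ ((B ^ 2).card : ℝ) * (4 * q) := by
    have h2m : 2 ≤ m := by omega
    have : ((m - 2 : ℕ) : ℝ) = (m : ℝ) - 2 := by push_cast [h2m]; ring
    rw [← this]
    exact_mod_cast hfin
  have hG' : (q : ℝ) ^ 3 ≤ 2 * Fintype.card SL(2, F) := by exact_mod_cast hG
  have hqx : (q : ℝ) ^ 2 * x ≤ 16 * L * n := by
    refine le_of_mul_le_mul_left ?_ hq0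
    calc (q : ℝ) * ((q : ℝ) ^ 2 * x) = (q : ℝ) ^ 3 * x := by ring
      _ ≤ (2 * Fintype.card SL(2, F)) * (2 * ((m : ℝ) - 2)) := by
        gcongr
        linarith
      _ = 4 * (Fintype.card SL(2, F) * ((m : ℝ) - 2)) := by ring
      _ ≤ 4 * ((B ^ 2).card * (4 * q)) := by gcongr
      _ ≤ 4 * ((L * n) * (4 * q)) := by gcongr
      _ = _ := by ring
  have hcube : ((q : ℝ) ^ 2 * x) ^ 3 ≤ (16 * L * n) ^ 3 := by gcongr
  have : (q : ℝ) ^ 6 * (n / c) ≤ 4096 * L ^ 3 * n ^ 3 := by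
    rw [← hx]
    calc (q : ℝ) ^ 6 * x ^ 3 = ((q : ℝ) ^ 2 * x) ^ 3 := by ring
      _ ≤ _ := hcube
      _ = _ := by ring
  refine le_of_mul_le_mul_right (a := n / c) ?_ (by positivity)
  refine this.trans (le_of_eq ?_)
  rw [hc]
  field_simp
  ring

end SLTwo

/-! ### The product theorem -/

namespace SLTwo

/-- For integers `a` up to `C`, the bound `a ^ (1 + δ)` is at most `a + 1` once `δ` is small. -/
theorem exists_rpow_le_add_one (C : ℕ) (hC : 2 ≤ C) : ∃ δ₁ : ℝ, 0 < δ₁ ∧ ∀ δ : ℝ, 0 < δ → δ ≤ δ₁ →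
    ∀ a : ℕ, 1 ≤ a → a ≤ C → (a : ℝ) ^ (1 + δ) ≤ a + 1 := by
  have hC1 : (1 : ℝ) < C := by exact_mod_cast hC
  have hlogC : 0 < Real.log C := Real.log_pos hC1
  have hlog : 0 < Real.log (1 + 1 / C) := Real.log_pos (by
    have : (0 : ℝ) < 1 / C := by positivity
    linarith)
  refine ⟨Real.log (1 + 1 / C) / Real.log C, by positivity, ?_⟩
  intro δ hδ hδ₁ a ha haC
  have ha0 : (0 : ℝ) < a := by exact_mod_cast ha
  have haC' : (a : ℝ) ≤ C := by exact_mod_cast haC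
  have h1 : (a : ℝ) ^ δ ≤ 1 + 1 / C := by
    calc (a : ℝ) ^ δ ≤ (C : ℝ) ^ δ := Real.rpow_le_rpow ha0.le haC' hδ.le
      _ ≤ (C : ℝ) ^ (Real.log (1 + 1 / C) / Real.log C) :=
        Real.rpow_le_rpow_of_exponent_le hC1.le hδ₁
      _ = 1 + 1 / C := by
        rw [Real.rpow_def_of_pos (by positivity), mul_div_cancel₀ _ hlogC.ne',
          Real.exp_log (by positivity)]
  calc (a : ℝ) ^ (1 + δ) = a * (a : ℝ) ^ δ := by rw [Real.rpow_add ha0, Real.rpow_one]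
    _ ≤ a * (1 + 1 / C) := by gcongr
    _ = a + a / C := by ring
    _ ≤ a + 1 := by
      gcongr
      rw [div_le_one (by positivity)]
      exact haC'

/-- The main case of the growth theorem: `A` and the field are both large. -/
theorem pow_eq_univ_of_small_tripling {F : Type*} [Field F] [Fintype F] [DecidableEq F]
    {A : Finset SL(2, F)} (hA : Subgroup.closure (A : Set SL(2, F)) = ⊤) (hne : A.Nonempty)
    {δ : ℝ} (hδ0 : 0 < δ) (hδ : δ ≤ 1 / 1260)
    (hAC : (343 * (4096 * 27 ^ 32)) ^ 2 ≤ A.card)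
    (hq : 2 ^ 78 * 27 ^ 105 < Fintype.card F)
    (h3 : ((A ^ 3).card : ℝ) < (A.card : ℝ) ^ (1 + δ)) :
    (A ∪ A⁻¹ ∪ {1}) ^ 64 = Finset.univ := by
  set B := A ∪ A⁻¹ ∪ {1} with hBdef
  set q := Fintype.card F with hqdef
  obtain ⟨a, ha⟩ : ∃ a : ℝ, a = A.card := ⟨_, rfl⟩
  obtain ⟨n, hnB⟩ : ∃ n : ℝ, n = B.card := ⟨_, rfl⟩
  have ha1 : 1 ≤ a := by rw [ha]; exact_mod_cast hne.card_pos
  have hAB : A ⊆ B := fun x hx ↦ by simp [hBdef, hx]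
  have han : a ≤ n := by rw [ha, hnB]; exact_mod_cast Finset.card_le_card hAB
  have h1 : (1 : SL(2, F)) ∈ B := by simp [hBdef]
  have hinv : B⁻¹ = B := A.symm_inv
  have hBgen : Subgroup.closure (B : Set SL(2, F)) = ⊤ := by
    rw [eq_top_iff, ← hA]
    exact Subgroup.closure_mono (by exact_mod_cast hAB)
  set K : ℝ := a ^ δ with hK
  have hK1 : 1 ≤ K := Real.one_le_rpow ha1 hδ0.le
  have hA3 : ((A ^ 3).card : ℝ) ≤ K * A.card := by
    refine h3.le.trans (le_of_eq ?_)
    rw [← ha, Real.rpow_add (by linarith), Real.rpow_one, mul_comm]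
  have hB3 := Finset.card_symm_pow_three_le hne hA3
  obtain ⟨L, hLK⟩ : ∃ L : ℝ, L = 27 * K ^ 3 := ⟨_, rfl⟩
  have hK3 : 1 ≤ K ^ 3 := one_le_pow₀ hK1
  have hL1 : 1 ≤ L := by rw [hLK]; linarith
  rw [← hLK, ← hBdef, ← ha] at hB3
  have hB3' : ((B ^ 3).card : ℝ) ≤ L * B.card := by
    rw [← hnB]
    exact hB3.trans (by gcongr)
  -- powers of `K` are absorbed into `a` and `q`
  have hK96 : K ^ 96 ≤ a ^ (1 / 2 : ℝ) := by
    rw [hK, ← Real.rpow_natCast, ← Real.rpow_mul (by linarith)]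
    exact Real.rpow_le_rpow_of_exponent_le ha1 (by push_cast; linarith)
  have hq0 : (1 : ℝ) ≤ q := by exact_mod_cast (Fintype.card_pos : 0 < Fintype.card F)
  have haq : a ≤ (q : ℝ) ^ 4 := by
    rw [ha]
    exact_mod_cast (Finset.card_le_univ A).trans card_le_pow_four
  have hK315 : K ^ 315 ≤ q := by
    rw [hK, ← Real.rpow_natCast, ← Real.rpow_mul (by linarith)]
    calc a ^ (δ * (315 : ℕ)) ≤ ((q : ℝ) ^ 4) ^ (δ * (315 : ℕ)) :=
          Real.rpow_le_rpow (by linarith) haq (by positivity)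
      _ = (q : ℝ) ^ (4 * (δ * (315 : ℕ))) := by
          rw [← Real.rpow_natCast, ← Real.rpow_mul (by linarith)]
          norm_num
      _ ≤ (q : ℝ) ^ (1 : ℝ) := Real.rpow_le_rpow_of_exponent_le hq0 (by push_cast; linarith)
      _ = q := Real.rpow_one _
  have hsqrt : (343 * (4096 * 27 ^ 32) : ℝ) ≤ a ^ (1 / 2 : ℝ) := by
    rw [← Real.sqrt_eq_rpow]
    apply Real.le_sqrt_of_sq_le
    rw [ha]
    exact_mod_cast hAC
  have hn : 343 * (4096 * L ^ 32) ≤ (B.card : ℝ) := by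
    rw [← hnB]
    refine le_trans ?_ han
    calc 343 * (4096 * L ^ 32) = 343 * (4096 * 27 ^ 32) * K ^ 96 := by rw [hLK]; ring
      _ ≤ a ^ (1 / 2 : ℝ) * a ^ (1 / 2 : ℝ) := by gcongr
      _ = a := by
        rw [← Real.rpow_add (by linarith)]
        norm_num
  have hmain := card_pow_six_le hBgen h1 hinv hL1 hB3' hn
  rw [← hqdef, ← hnB] at hmain
  apply pow_eq_univ_of_card hinv
  rw [← hqdef]
  have hL105 : 2 ^ 78 * L ^ 105 < (q : ℝ) ^ 2 := by
    have hq' : (2 ^ 78 * 27 ^ 105 : ℝ) < q := by exact_mod_cast hq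
    calc 2 ^ 78 * L ^ 105 = (2 ^ 78 * 27 ^ 105) * K ^ 315 := by rw [hLK]; ring
      _ < q * K ^ 315 := by gcongr
      _ ≤ q * q := by gcongr
      _ = _ := by ring
  have hL0 : 0 < L := by linarith
  have hn0 : 0 < n := by linarith
  have hsq : (8 * (q : ℝ) ^ 8) ^ 2 < (n ^ 3) ^ 2 := by
    have h18 : ((q : ℝ) ^ 6) ^ 3 ≤ (2 ^ 24 * L ^ 35 * n ^ 2) ^ 3 := by gcongr
    have h72 : (0 : ℝ) < 2 ^ 72 * L ^ 105 := by positivity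
    refine lt_of_mul_lt_mul_left ?_ h72.le
    calc 2 ^ 72 * L ^ 105 * (8 * (q : ℝ) ^ 8) ^ 2 = (2 ^ 78 * L ^ 105) * (q : ℝ) ^ 16 := by ring
      _ < (q : ℝ) ^ 2 * (q : ℝ) ^ 16 := by gcongr
      _ = ((q : ℝ) ^ 6) ^ 3 := by ring
      _ ≤ _ := h18
      _ = _ := by ring
  have := lt_of_pow_lt_pow_left₀ 2 (by positivity) hsq
  rw [hnB] at this
  exact_mod_cast this

end SLTwo

theorem theorem1p1 :
    ∃ (δ : ℝ) (k : ℕ), 0 < δ ∧ 1 ≤ k ∧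
      ∀ (F : Type*) [Field F] [Finite F] (A : Set (Matrix.SpecialLinearGroup (Fin 2) F)),
        Subgroup.closure A = ⊤ →
          ((A.ncard : ℝ) ^ (1 + δ) ≤ ((A ^ 3).ncard : ℝ) ∨
            (A ∪ A⁻¹ ∪ {1}) ^ k = Set.univ) := by
  obtain ⟨C, hC⟩ : ∃ C : ℕ, C = (343 * (4096 * 27 ^ 32)) ^ 2 := ⟨_, rfl⟩
  obtain ⟨Q, hQ⟩ : ∃ Q : ℕ, Q = 2 ^ 78 * 27 ^ 105 + 4 * C := ⟨_, rfl⟩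
  have hC2 : 2 ≤ C := by rw [hC]; norm_num
  obtain ⟨δ₁, hδ₁, hsmall⟩ := SLTwo.exists_rpow_le_add_one C hC2
  refine ⟨min (1 / 1260) δ₁, 64 + Q ^ 4, by positivity, by omega, ?_⟩
  intro F _ _ A hgen
  classical
  have := Fintype.ofFinite F
  lift A to Finset (Matrix.SpecialLinearGroup (Fin 2) F) using A.toFinite
  obtain ⟨δ, hδ⟩ : ∃ δ, δ = min (1 / 1260) δ₁ := ⟨_, rfl⟩
  have hδ0 : 0 < δ := by rw [hδ]; positivity
  rw [← hδ, ← Finset.coe_pow, Set.ncard_coe_finset, Set.ncard_coe_finset]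
  by_contra! hcon
  obtain ⟨h3, hk⟩ := hcon
  have hne : A.Nonempty := by
    obtain ⟨x, hx, -⟩ := SLTwo.exists_not_isScalar hgen
    exact ⟨x, hx⟩
  have h1 : (1 : Matrix.SpecialLinearGroup (Fin 2) F) ∈ A ∪ A⁻¹ ∪ {1} := by simp
  apply hk
  have hset : ((A : Set (Matrix.SpecialLinearGroup (Fin 2) F)) ∪ (A : Set _)⁻¹ ∪ {1}) =
      ((A ∪ A⁻¹ ∪ {1} : Finset (Matrix.SpecialLinearGroup (Fin 2) F)) : Set _) := by
    push_cast
    rfl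
  rw [hset, ← Finset.coe_pow, Finset.coe_eq_univ]
  by_cases hq : Q < Fintype.card F
  · by_cases hAC : C ≤ A.card
    · have h64 := SLTwo.pow_eq_univ_of_small_tripling hgen hne hδ0 (hδ ▸ min_le_left _ _)
        (hC ▸ hAC) (by omega) h3
      exact Finset.univ_subset_iff.1
        (h64 ▸ Finset.pow_subset_pow_right h1 (Nat.le_add_right 64 (Q ^ 4)))
    · -- here `|A ^ 3| < |A| + 1`, so that `A` does not grow at all
      have hle := hsmall δ hδ0 (hδ ▸ min_le_right _ _) A.card hne.card_pos (by omega)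
      have hlt : (A ^ 3).card < A.card + 1 := by exact_mod_cast h3.trans_le hle
      have h4 := SLTwo.sq_card_le_of_card_pow_three_le hgen (Nat.lt_succ_iff.1 hlt)
      have h5 : Fintype.card F ≤ Fintype.card F ^ 2 := Nat.le_self_pow (by norm_num) _
      omega
  · refine Finset.pow_eq_univ_of_card_le ?_ h1 A.symm_inv ?_
    · rw [eq_top_iff, ← hgen]
      exact Subgroup.closure_mono fun x hx ↦ by simp [Finset.mem_coe.1 hx]
    · calc Fintype.card (Matrix.SpecialLinearGroup (Fin 2) F) ≤ Fintype.card F ^ 4 :=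
            SLTwo.card_le_pow_four
        _ ≤ Q ^ 4 := Nat.pow_le_pow_left (by omega) 4
        _ ≤ 64 + Q ^ 4 := Nat.le_add_left _ _
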